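/- Let $T>0$ and let $W$ be a standard one-dimensional Brownian motion on a probability space $(\Omega,\mathcal F,\mathbb P)$, with its natural filtration, completed and made right-continuous. For $g:\mathbb R\to\mathbb R$ and $h:[0,T]\times\mathbb R^3\to\mathbb R$, let $(Y,Z)\in\mathbb S^2\times\mathbb H^2$ be a solution of the BSDE $$Y_t=g(W_T)+\int_t^T h(s,W_s,Y_s,Z_s)\,ds-\int_t^T Z_s\,dW_s,\qquad t\in[0,T],\ \mathbb P\text{-a.s.},$$ that is, $Y$ is continuous and progressively measurable with $\mathbb E[\sup_{t\le T}|Y_t|^2]<\infty$, $Z$ is predictable with $\mathbb E\int_0^T|Z_s|^2ds<\infty$, and $s\mapsto h(s,W_s,Y_s,Z_s)$ is a.s. integrable on $[0,T]$. Assume that there is $v:[0,T]\times\mathbb R\to\mathbb R$ of class $C^{1,2}$ (once differentiable in $t$, twice in $x$, with jointly continuous partial derivatives) such that $Y_t=v(t,W_t)$ a.s. for all $t\in[0,T]$. Denote by $v',v''$ the space derivatives of $v$. For $f:\mathbb R\to\mathbb R$ set $$\overline{\alpha}_f=\inf\Big\{\alpha>0:\limsup_{|x|\to\infty}\frac{|f(x)|}{|x|^\alpha}<\infty\Big\},\qquad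 \underline{\alpha}_f=\inf\Big\{\alpha>0:\liminf_{|x|\to\infty}\frac{|f(x)|}{|x|^\alpha}<\infty\Big\}$$ in $[0,\infty]$ (with $\inf\emptyset=\infty$). Fix $t\in(0,T]$; growth rates of $v,v',v''$ are those of $v(t,\cdot),v'(t,\cdot),v''(t,\cdot)$. (i) Suppose that $v'(t,x)>0$ for all $x$, that $0\le\overline{\alpha}_{v'}<\underline{\alpha}_v<\infty$, and that there are $K,\tilde\alpha>0$ with $v'(t,x)\ge \frac1{K(1+|x|^{\tilde\alpha})}$ for all $x\in\mathbb R$. Then $Y_t$ is integrable, its law has a continuous density $\rho$ with respect to Lebesgue measure, and, with $m=\mathbb E[Y_t]$ and $A=\mathbb E|Y_t-m|$: (a) there exist $y_0,C_1,C_2>0$, $p_1\in(0,2)$ and $p_2>0$ such that for all $|y|>y_0$ $$\rho(y)\ge\frac{A}{C_2t\,(1+|y|^{1-p_1/2})}\exp\Big(-\frac{|y-m|^{2(p_2+1)}-|y_0-m|^{2(p_2+1)}}{(p_2+1)C_2t}\Big),$$ $$\rho(y)\le\frac{A}{C_1t}\big(1+|y|^{2p_2}\big)\exp\Big(-\frac{2|y_0-m|^2}{C_2t}\big(1+y_0^{2p_2}\big)\Big)\exp\Big(-\frac{|y-m|^{p_1}-|y_0-m|^{p_1}}{p_1C_2t}\Big);$$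 (b) $v(t,\cdot)$ is a bijection of $\mathbb R$ whose inverse $w$ satisfies $\overline{\alpha}_w<\infty$, and there are $\varepsilon,\varepsilon'>0$ with $\gamma:=(\overline{\alpha}_{v'}+\varepsilon)(\overline{\alpha}_w+\varepsilon')\in(0,1)$ such that for the explicit exponents $p_1=2(1-\gamma)$ and $p_2=\tilde\alpha(\overline{\alpha}_w+\varepsilon')>0$ there exist $y_0,C_1,C_2>0$ for which the two inequalities of (a) hold for all $|y|>y_0$, with $C_2$ replaced by $C_1$ in the denominator $(p_2+1)C_2t$ of the exponential of the lower bound. (ii) Let moreover $Z$ be the version of the second component of the solution whose paths are a.s. continuous on $[0,T]$. Suppose that $v''(t,x)>0$ for all $x$, that $0\le\overline{\alpha}_{v''}<\underline{\alpha}_{v'}<\infty$, and that there are $K,\tilde\alpha>0$ with $v''(t,x)\ge\frac1{K(1+|x|^{\tilde\alpha})}$ for all $x\in\mathbb R$. (The assumptions of (i) are not needed here.) Then all the conclusions of (i) hold with $Z_t$ in place of $Y_t$, and with $v',v''$ in place of $v,v'$. -/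

import Mathlib

open MeasureTheory ProbabilityTheory
open scoped NNReal ENNReal

namespace BSDEDensity

noncomputable section

/-! ### Growth rates -/

/-- The upper growth rate of `f`: the infimum (in `[0, ∞]`) of all `α > 0` such that
`limsup_{|x| → ∞} |f x| / |x| ^ α < ∞`. -/
def upperGrowth (f : ℝ → ℝ) : ℝ≥0∞ :=
  ⨅ (α : ℝ) (_ : 0 < α)
    (_ : Filter.limsup (fun x => ENNReal.ofReal (|f x| / |x| ^ α)) (Filter.cocompact ℝ) < ⊤),
    ENNReal.ofReal α

/-- The lower growth rate of `f`: the infimum (in `[0, ∞]`) of all `α > 0` such that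
`liminf_{|x| → ∞} |f x| / |x| ^ α < ∞`. -/
def lowerGrowth (f : ℝ → ℝ) : ℝ≥0∞ :=
  ⨅ (α : ℝ) (_ : 0 < α)
    (_ : Filter.liminf (fun x => ENNReal.ofReal (|f x| / |x| ^ α)) (Filter.cocompact ℝ) < ⊤),
    ENNReal.ofReal α

/-- `v` is of class `C^{1,2}` on `[0, T] × ℝ`: once differentiable in time (one-sidedly at the
end points) and twice in space, with all these partial derivatives jointly continuous. -/
structure IsC12 (T : ℝ) (v : ℝ → ℝ → ℝ) : Prop where
  continuousOn : ContinuousOn (fun p : ℝ × ℝ => v p.1 p.2) (Set.Icc 0 T ×ˢ Set.univ)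
  diff_time : ∀ t ∈ Set.Icc 0 T, ∀ x,
    DifferentiableWithinAt ℝ (fun s => v s x) (Set.Icc 0 T) t
  continuousOn_time : ContinuousOn
    (fun p : ℝ × ℝ => derivWithin (fun s => v s p.2) (Set.Icc 0 T) p.1)
    (Set.Icc 0 T ×ˢ Set.univ)
  diff_space : ∀ t ∈ Set.Icc 0 T, Differentiable ℝ (v t)
  continuousOn_space : ContinuousOn
    (fun p : ℝ × ℝ => deriv (v p.1) p.2) (Set.Icc 0 T ×ˢ Set.univ)
  diff_space_two : ∀ t ∈ Set.Icc 0 T, Differentiable ℝ (deriv (v t))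
  continuousOn_space_two : ContinuousOn
    (fun p : ℝ × ℝ => deriv (deriv (v p.1)) p.2) (Set.Icc 0 T ×ˢ Set.univ)

/-! ### Brownian filtration, Itô integral, BSDE -/

section

variable {Ω : Type*} [mΩ : MeasurableSpace Ω]

/-- The σ-algebra generated by the `P`-null events. -/
@[reducible] def nullEvents (P : Measure Ω) : MeasurableSpace Ω :=
  MeasurableSpace.generateFrom {A | MeasurableSet A ∧ P A = 0}

theorem nullEvents_le (P : Measure Ω) : nullEvents P ≤ mΩ :=
  MeasurableSpace.generateFrom_le fun _ hA => hA.1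

/-- The natural filtration of `W`, completed by the null events and made right-continuous. -/
def augmentedFiltration (P : Measure Ω) (W : ℝ≥0 → Ω → ℝ) (hW : ∀ t, Measurable (W t)) :
    Filtration ℝ≥0 mΩ :=
  (Filtration.natural W (fun t => (hW t).stronglyMeasurable) ⊔
    Filtration.const ℝ≥0 (nullEvents P) (nullEvents_le P)).rightCont

/-- A simple integrand `∑_{i < n} ξ_i 1_{(t_i, t_{i+1}]}` with `t_0 ≤ t_1 ≤ ⋯` and with `ξ_i`
bounded and `𝓕_{t_i}`-measurable. -/
structure SimpleIntegrand (𝓕 : Filtration ℝ≥0 mΩ) where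
  n : ℕ
  time : ℕ → ℝ≥0
  time_mono : Monotone time
  ξ : ℕ → Ω → ℝ
  ξ_meas : ∀ i, Measurable[𝓕 (time i)] (ξ i)
  ξ_bdd : ∀ i, ∃ c : ℝ, ∀ ω, |ξ i ω| ≤ c

/-- The value at time `s` of a simple integrand. -/
def SimpleIntegrand.eval {𝓕 : Filtration ℝ≥0 mΩ} (S : SimpleIntegrand 𝓕) (s : ℝ≥0) (ω : Ω) : ℝ :=
  ∑ i ∈ Finset.range S.n, (Set.Ioc (S.time i) (S.time (i + 1))).indicator (fun _ => S.ξ i ω) s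

/-- The integral over `[0, t]` of a simple integrand with respect to `W`. -/
def SimpleIntegrand.integral {𝓕 : Filtration ℝ≥0 mΩ} (S : SimpleIntegrand 𝓕)
    (W : ℝ≥0 → Ω → ℝ) (t : ℝ≥0) (ω : Ω) : ℝ :=
  ∑ i ∈ Finset.range S.n, S.ξ i ω * (W (min (S.time (i + 1)) t) ω - W (min (S.time i) t) ω)

/-- `I` is (a continuous version of) the Itô integral process `I_t = ∫_0^t Z_s dW_s` on `[0, T]`,
for `Z` square integrable over `[0, T] × Ω`: the `L²`-limit of the integrals of simple
integrands that converge to `Z` in `L²([0, T] × Ω)`. -/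
structure IsItoIntegral (P : Measure Ω) (𝓕 : Filtration ℝ≥0 mΩ) (W : ℝ≥0 → Ω → ℝ) (T : ℝ≥0)
    (Z I : ℝ≥0 → Ω → ℝ) : Prop where
  adapted : ∀ t ≤ T, Measurable[𝓕 t] (I t)
  cont : ∀ᵐ ω ∂P, ContinuousOn (fun t => I t ω) (Set.Icc 0 T)
  limit : ∃ S : ℕ → SimpleIntegrand 𝓕,
    Filter.Tendsto
      (fun n => ∫⁻ ω, ∫⁻ s in Set.Icc (0 : ℝ) T,
        ‖(S n).eval s.toNNReal ω - Z s.toNNReal ω‖ₑ ^ 2 ∂volume ∂P)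
      Filter.atTop (nhds 0) ∧
    ∀ t ≤ T, Filter.Tendsto
      (fun n => ∫⁻ ω, ‖(S n).integral W t ω - I t ω‖ₑ ^ 2 ∂P) Filter.atTop (nhds 0)

/-- `(Y, Z)` solves, in `𝕊² × ℍ²`, the Markovian BSDE
`Y_t = g(W_T) + ∫_t^T h(s, W_s, Y_s, Z_s) ds - ∫_t^T Z_s dW_s`, `t ∈ [0, T]`. -/
structure IsBSDESolution (P : Measure Ω) (𝓕 : Filtration ℝ≥0 mΩ) (W : ℝ≥0 → Ω → ℝ) (T : ℝ≥0)
    (g : ℝ → ℝ) (h : ℝ → ℝ → ℝ → ℝ → ℝ) (Y Z : ℝ≥0 → Ω → ℝ) : Prop where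
  Y_progressive : ∀ t ≤ T,
    StronglyMeasurable[Subtype.instMeasurableSpace.prod (𝓕 t)]
      (fun p : Set.Iic t × Ω => Y p.1 p.2)
  Y_continuous : ∀ᵐ ω ∂P, ContinuousOn (fun t => Y t ω) (Set.Icc 0 T)
  Y_sq : ∫⁻ ω, ⨆ t ∈ Set.Icc 0 T, ‖Y t ω‖ₑ ^ 2 ∂P < ⊤
  Z_predictable : IsStronglyPredictable 𝓕 (fun t ω => if t ≤ T then Z t ω else 0)
  Z_sq : ∫⁻ ω, ∫⁻ s in Set.Icc (0 : ℝ) T, ‖Z s.toNNReal ω‖ₑ ^ 2 ∂volume ∂P < ⊤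
  driver_integrable : ∀ᵐ ω ∂P, IntervalIntegrable
    (fun s : ℝ => h s (W s.toNNReal ω) (Y s.toNNReal ω) (Z s.toNNReal ω)) volume 0 T
  equation : ∃ I : ℝ≥0 → Ω → ℝ, IsItoIntegral P 𝓕 W T Z I ∧
    ∀ᵐ ω ∂P, ∀ t ≤ T,
      Y t ω = g (W T ω)
        + (∫ s in (t : ℝ)..T, h s (W s.toNNReal ω) (Y s.toNNReal ω) (Z s.toNNReal ω))
        - (I T ω - I t ω)

end

/-! ### Assumptions and conclusions of the density estimate -/

/-- `f' > 0`, `0 ≤ (upper rate of f') < (lower rate of f) < ∞`, and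
`f'(x) ≥ 1 / (K (1 + |x| ^ a))`. -/
structure TailAssumptions (f : ℝ → ℝ) (K a : ℝ) : Prop where
  deriv_pos : ∀ x, 0 < deriv f x
  growth_lt : upperGrowth (deriv f) < lowerGrowth f
  growth_lt_top : lowerGrowth f < ⊤
  K_pos : 0 < K
  a_pos : 0 < a
  lower_bound : ∀ x, 1 / (K * (1 + |x| ^ a)) ≤ deriv f x

/-- The two tail estimates of a density `ρ`, where `m` is the mean and `A` the mean absolute
deviation of the law, and `C` is the constant in the exponential of the lower bound. -/
def TailBounds (ρ : ℝ → ℝ) (m A t y₀ C C₁ C₂ p₁ p₂ : ℝ) : Prop :=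
  ∀ y : ℝ, y₀ < |y| →
    A / (C₂ * t * (1 + |y| ^ (1 - p₁ / 2)))
        * Real.exp (-((|y - m| ^ (2 * (p₂ + 1)) - |y₀ - m| ^ (2 * (p₂ + 1)))
            / ((p₂ + 1) * C * t)))
      ≤ ρ y ∧
    ρ y ≤ A / (C₁ * t) * (1 + |y| ^ (2 * p₂))
        * Real.exp (-(2 * |y₀ - m| ^ 2 / (C₂ * t) * (1 + y₀ ^ (2 * p₂))))
        * Real.exp (-((|y - m| ^ p₁ - |y₀ - m| ^ p₁) / (p₁ * C₂ * t)))

/-- The integrable random variable `X` has a (continuous) density that satisfies the tail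
estimates, first with the constant `C₂` in the exponential of the lower bound, and then, with
`C₁` in that place, for the explicit exponents
`p₁ = 2 (1 - (α + ε) (α' + ε'))` and `p₂ = a (α' + ε')`,
where `α`, `α'` are the upper growth rates of `f'` and of the inverse function of `f`. -/
def HasTailEstimates {Ω : Type*} [MeasurableSpace Ω] (P : Measure Ω) (X : Ω → ℝ) (t : ℝ)
    (f : ℝ → ℝ) (a : ℝ) : Prop :=
  Integrable X P ∧
  ∃ ρ : ℝ → ℝ, Continuous ρ ∧ (∀ y, 0 ≤ ρ y) ∧
    P.map X = volume.withDensity (fun y => ENNReal.ofReal (ρ y)) ∧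
    (∃ y₀ C₁ C₂ p₁ p₂ : ℝ, 0 < y₀ ∧ 0 < C₁ ∧ 0 < C₂ ∧ 0 < p₁ ∧ p₁ < 2 ∧ 0 < p₂ ∧
      TailBounds ρ (∫ ω, X ω ∂P) (∫ ω, |X ω - ∫ ω', X ω' ∂P| ∂P) t y₀ C₂ C₁ C₂ p₁ p₂) ∧
    (∃ w : ℝ → ℝ, Function.LeftInverse w f ∧ Function.RightInverse w f ∧ upperGrowth w < ⊤ ∧
      ∃ ε ε' γ p₁ p₂ : ℝ, 0 < ε ∧ 0 < ε' ∧
        γ = ((upperGrowth (deriv f)).toReal + ε) * ((upperGrowth w).toReal + ε') ∧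
        0 < γ ∧ γ < 1 ∧ p₁ = 2 * (1 - γ) ∧ p₂ = a * ((upperGrowth w).toReal + ε') ∧ 0 < p₂ ∧
        ∃ y₀ C₁ C₂ : ℝ, 0 < y₀ ∧ 0 < C₁ ∧ 0 < C₂ ∧
          TailBounds ρ (∫ ω, X ω ∂P) (∫ ω, |X ω - ∫ ω', X ω' ∂P| ∂P) t y₀ C₁ C₁ C₂ p₁ p₂)

end

end BSDEDensity

/-!
Let `f` be `v t` in the first part and `deriv (v t)` in the second one. The random variable under
study is `f (W t)`, and `W t` is Gaussian; everything about its law follows from this.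

**Tails.** The growth assumptions make `f` an increasing bijection with an inverse `w` of polynomial
growth, and `w' = 1 / f' ∘ w` lies between multiples of `1 / (1 + |y| ^ γ)` and `1 + |y| ^ p₂`
(`exists_orderIso_of_tailAssumptions`). The density of `f (W t)` is `ρ = φ_t(w) * w'`, with `φ_t` the
density of the Gaussian law of variance `t` (`gaussianReal_map_eq_withDensity`). Integrating the
bounds on `w'` confines `w ^ 2` between powers `|y - m| ^ (2 (1 - γ))` and `|y - m| ^ (2 (p₂ + 1))`,
up to constants (`exists_sq_bounds`), which is the shape of the two tail estimates. It remains to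
choose the constants. For the explicit exponents, `C₁` may be small and `C₂` large independently of
each other (`exists_tailBounds_explicit`). When the same `C₂` has to serve in both exponentials, the
freedom lies in the exponent `p₂`, which is taken large (`exists_tailBounds`).
`hasTailEstimates_of_hasLaw` collects these facts.

**Identification of `Z`.** For the second part one needs `Z t = v'(t, W t)` almost surely. This is
proved without Itô's formula, by comparing increments over `[s, s + δ]` at scale `√δ`. On the one
hand `v(s + δ, W (s + δ)) - v(s, W s)` is `v'(s, W s) * (W (s + δ) - W s)` up to `o(√δ)`. On the other
hand, by the equation, it is an increment of `∫ Z dW` up to the increment of a Lebesgue integral,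
which is `O(δ)` at almost every `s`; and the increment of `∫ Z dW` is close, in mean square, to that
of the integral of an approximating simple integrand, which is constant just after `s`. The last
error is controlled by the isometry for simple integrands (`lintegral_increment_sub_le`) together
with the Lebesgue differentiation theorem. Since `W (s + δ) - W s` is independent of the past and of
size `√δ`, the two coefficients coincide (`ae_eq_of_gaussian_increment`). This gives
`Z s = v'(s, W s)` for almost every `s` (`IsBSDESolution.ae_eq_deriv`), hence for every `s` in
`(0, T]` if `Z` has continuous paths. The independence of increments has to hold for the completed,
right-continuous filtration (`isBrownianWrt_augmentedFiltration`).
-/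

namespace BSDEDensity

open Filter Topology

/-! ### Growth rates and inverse functions -/

theorem exists_abs_le_of_upperGrowth_lt {g : ℝ → ℝ} (hg : Continuous g) {β : ℝ}
    (h : upperGrowth g < ENNReal.ofReal β) :
    ∃ C, 0 < C ∧ ∀ x, |g x| ≤ C * (1 + |x| ^ β) := by
  simp only [upperGrowth, iInf_lt_iff] at h
  obtain ⟨α, hα, hlim, hαβ⟩ := h
  have hαβ' : α < β := ((ENNReal.ofReal_lt_ofReal_iff_of_nonneg hα.le).1 hαβ)
  obtain ⟨c, hc1, hc2⟩ := exists_between hlim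
  have hev := eventually_lt_of_limsup_lt hc1
  have hone := (tendsto_norm_cocompact_atTop (E := ℝ)).eventually_ge_atTop 1
  obtain ⟨t, ht, hts⟩ := mem_cocompact.1 (hev.and hone)
  obtain ⟨D, hD⟩ := ht.exists_bound_of_continuousOn hg.continuousOn
  refine ⟨c.toReal + |D| + 1, by positivity, fun x => ?_⟩
  have hpos : 0 ≤ |x| ^ β := by positivity
  by_cases hx : x ∈ t
  · have h1 := hD x hx
    rw [Real.norm_eq_abs] at h1
    have h2 := le_abs_self D
    have h3 : 0 ≤ c.toReal := by positivity
    nlinarith [abs_nonneg D]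
  · obtain ⟨h1, h2⟩ := hts hx
    rw [Real.norm_eq_abs] at h2
    have h3 : |g x| / |x| ^ α < c.toReal := (ENNReal.ofReal_lt_iff_lt_toReal (by positivity) hc2.ne).1 h1
    have h4 : 0 < |x| ^ α := by positivity
    rw [div_lt_iff₀ h4] at h3
    have h5 : |x| ^ α ≤ |x| ^ β := Real.rpow_le_rpow_of_exponent_le h2 hαβ'.le
    have h6 : 0 ≤ c.toReal := by positivity
    nlinarith [abs_nonneg D, mul_le_mul_of_nonneg_left h5 h6]

theorem eventually_rpow_le_of_lt_lowerGrowth {f : ℝ → ℝ} {α : ℝ} (hα : 0 < α)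
    (h : ENNReal.ofReal α < lowerGrowth f) :
    ∀ᶠ x in cocompact ℝ, |x| ^ α ≤ |f x| := by
  have hlim : (1 : ℝ≥0∞) <
      liminf (fun x => ENNReal.ofReal (|f x| / |x| ^ α)) (cocompact ℝ) := by
    by_contra hcon
    refine absurd h (not_lt.2 (iInf₂_le_of_le α hα (iInf_le _ ?_)))
    exact (not_lt.1 hcon).trans_lt ENNReal.one_lt_top
  have hone := (tendsto_norm_cocompact_atTop (E := ℝ)).eventually_ge_atTop 1
  filter_upwards [eventually_lt_of_lt_liminf hlim, hone] with x h1 h2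
  rw [Real.norm_eq_abs] at h2
  rw [← ENNReal.ofReal_one, ENNReal.ofReal_lt_ofReal_iff_of_nonneg zero_le_one] at h1
  have h4 : 0 < |x| ^ α := by positivity
  rw [lt_div_iff₀ h4] at h1
  linarith

/-- A strictly increasing continuous function whose modulus dominates a positive power of `|x|`
near infinity is an increasing bijection of the line. -/
theorem exists_orderIso_of_rpow_le {f : ℝ → ℝ} (hc : Continuous f) (hm : StrictMono f) {α : ℝ}
    (hα : 0 < α) (h : ∀ᶠ x in cocompact ℝ, |x| ^ α ≤ |f x|) :
    ∃ e : ℝ ≃o ℝ, ∀ x, e x = f x := by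
  have habs : Tendsto (fun x => |f x|) (cocompact ℝ) atTop :=
    tendsto_atTop_mono' _ h
      ((tendsto_rpow_atTop hα).comp (tendsto_norm_cocompact_atTop (E := ℝ)))
  rw [cocompact_eq_atBot_atTop] at habs
  have htop : Tendsto f atTop atTop := by
    refine tendsto_atTop.2 fun b => ?_
    filter_upwards [(habs.mono_left le_sup_right).eventually_ge_atTop (max b (|f 0| + 1)),
      eventually_ge_atTop 0] with x h1 h2
    have h3 := hm.monotone h2
    have h4 := neg_abs_le (f 0)
    rcases abs_cases (f x) with ⟨h5, _⟩ | ⟨h5, _⟩ <;> rw [h5] at h1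
    · exact (le_max_left _ _).trans h1
    · have := (le_max_right _ _).trans h1
      linarith
  have hbot : Tendsto f atBot atBot := by
    refine tendsto_atBot.2 fun b => ?_
    filter_upwards [(habs.mono_left le_sup_left).eventually_ge_atTop (max (-b) (|f 0| + 1)),
      eventually_le_atBot 0] with x h1 h2
    have h3 := hm.monotone h2
    have h4 := le_abs_self (f 0)
    rcases abs_cases (f x) with ⟨h5, _⟩ | ⟨h5, _⟩ <;> rw [h5] at h1
    · have := (le_max_right _ _).trans h1
      linarith
    · have := (le_max_left _ _).trans h1
      linarith
  exact ⟨hm.orderIsoOfSurjective f (hc.surjective htop hbot), fun x => rfl⟩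

theorem upperGrowth_symm_le {f : ℝ → ℝ} (e : ℝ ≃o ℝ) (he : ∀ x, e x = f x) {α : ℝ}
    (hα : 0 < α) (h : ∀ᶠ x in cocompact ℝ, |x| ^ α ≤ |f x|) :
    upperGrowth e.symm ≤ ENNReal.ofReal α⁻¹ := by
  refine iInf₂_le_of_le α⁻¹ (inv_pos.2 hα) (iInf_le _ ?_)
  have hcc : Tendsto e.symm (cocompact ℝ) (cocompact ℝ) :=
    e.symm.toHomeomorph.isClosedEmbedding.tendsto_cocompact
  have hone := (tendsto_norm_cocompact_atTop (E := ℝ)).eventually_ge_atTop 1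
  refine (limsup_le_of_le (a := 1) ?_ ?_).trans_lt ENNReal.one_lt_top
  · exact isCobounded_le_of_bot
  · filter_upwards [hcc.eventually h, hone] with y h1 h2
    rw [Real.norm_eq_abs] at h2
    rw [← he, e.apply_symm_apply] at h1
    rw [ENNReal.ofReal_le_one]
    have h4 : 0 < |y| ^ α⁻¹ := by positivity
    rw [div_le_one h4, ← Real.rpow_rpow_inv (abs_nonneg (e.symm y)) hα.ne']
    exact Real.rpow_le_rpow (by positivity) h1 (inv_pos.2 hα).le

/-- Powers of a quantity of growth `|y| ^ κ`. -/
theorem rpow_le_of_le_one_add_rpow {C κ a : ℝ} (hC : 0 < C) (ha : 0 < a) {x y : ℝ}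
    (h : |x| ≤ C * (1 + |y| ^ κ)) : |x| ^ a ≤ (2 * C) ^ a * (1 + |y| ^ (a * κ)) := by
  have hy : 0 ≤ |y| ^ κ := by positivity
  have h1 : |x| ≤ 2 * C * max 1 (|y| ^ κ) := by
    have := le_max_left 1 (|y| ^ κ)
    have := le_max_right 1 (|y| ^ κ)
    nlinarith
  have h2 : |x| ^ a ≤ (2 * C * max 1 (|y| ^ κ)) ^ a := Real.rpow_le_rpow (abs_nonneg _) h1 ha.le
  rw [Real.mul_rpow (by positivity) (by positivity)] at h2
  refine h2.trans (mul_le_mul_of_nonneg_left ?_ (by positivity))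
  rcases max_cases 1 (|y| ^ κ) with ⟨h3, _⟩ | ⟨h3, _⟩ <;> rw [h3]
  · rw [Real.one_rpow]
    have : 0 ≤ |y| ^ (a * κ) := by positivity
    linarith
  · rw [← Real.rpow_mul (abs_nonneg y), mul_comm κ a]
    linarith

/-- The growth assumptions make `f` an increasing bijection, and they give polynomial bounds on the
derivative `1 / (f' ∘ f⁻¹)` of its inverse, with matching exponents. -/
theorem exists_orderIso_of_tailAssumptions {f : ℝ → ℝ} {K a : ℝ} (hf : Differentiable ℝ f)
    (hf' : Continuous (deriv f)) (h : TailAssumptions f K a) :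
    ∃ e : ℝ ≃o ℝ, (∀ x, e x = f x) ∧ upperGrowth e.symm < ⊤ ∧ ∃ ε ε' γ : ℝ, 0 < ε ∧ 0 < ε' ∧
      γ = ((upperGrowth (deriv f)).toReal + ε) * ((upperGrowth e.symm).toReal + ε') ∧
      0 < γ ∧ γ < 1 ∧ ∃ c C : ℝ, 0 < c ∧ 0 < C ∧ ∀ y,
        c / (1 + |y| ^ γ) ≤ (deriv f (e.symm y))⁻¹ ∧
        (deriv f (e.symm y))⁻¹ ≤ C * (1 + |y| ^ (a * ((upperGrowth e.symm).toReal + ε'))) := by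
  have hm : StrictMono f := strictMono_of_deriv_pos h.deriv_pos
  obtain ⟨α', hα1, hα2⟩ := exists_between h.growth_lt
  have hα'top : α' ≠ ⊤ := (hα2.trans h.growth_lt_top).ne
  set α := α'.toReal with hαdef
  have hα'eq : α' = ENNReal.ofReal α := (ENNReal.ofReal_toReal hα'top).symm
  have hα : 0 < α := ENNReal.toReal_pos (hα1.trans_le' (zero_le)).ne' hα'top
  rw [hα'eq] at hα1 hα2
  have hev := eventually_rpow_le_of_lt_lowerGrowth hα hα2
  obtain ⟨e, he⟩ := exists_orderIso_of_rpow_le hf.continuous hm hα hev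
  have hwle := upperGrowth_symm_le e he hα hev
  have hwtop : upperGrowth e.symm < ⊤ := hwle.trans_lt ENNReal.ofReal_lt_top
  set A := (upperGrowth (deriv f)).toReal with hA
  set B := (upperGrowth e.symm).toReal with hB
  have hA0 : 0 ≤ A := ENNReal.toReal_nonneg
  have hB0 : 0 ≤ B := ENNReal.toReal_nonneg
  have hAα : A < α := by
    have := ENNReal.toReal_strict_mono ENNReal.ofReal_ne_top hα1
    rwa [ENNReal.toReal_ofReal hα.le] at this
  have hBα : B ≤ α⁻¹ := by
    have := ENNReal.toReal_mono ENNReal.ofReal_ne_top hwle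
    rwa [ENNReal.toReal_ofReal (inv_pos.2 hα).le] at this
  have hAB : A * B < 1 := by
    calc A * B ≤ A * α⁻¹ := by gcongr
      _ < α * α⁻¹ := by gcongr
      _ = 1 := mul_inv_cancel₀ hα.ne'
  -- by continuity the product stays below one after a small enlargement of both factors
  obtain ⟨ε, hε, hABε⟩ : ∃ ε : ℝ, 0 < ε ∧ (A + ε) * (B + ε) < 1 := by
    have hcont : Tendsto (fun ε : ℝ => (A + ε) * (B + ε)) (𝓝[>] 0) (𝓝 (A * B)) := by
      have : Continuous (fun ε : ℝ => (A + ε) * (B + ε)) := by fun_prop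
      have h0 := this.tendsto 0
      simp only [add_zero] at h0
      exact h0.mono_left nhdsWithin_le_nhds
    obtain ⟨ε, h1, h2⟩ :=
      ((hcont.eventually_lt_const hAB).and self_mem_nhdsWithin).exists
    exact ⟨ε, h2, h1⟩
  have hderiv : upperGrowth (deriv f) < ENNReal.ofReal (A + ε) := by
    rw [← ENNReal.ofReal_toReal (hα1.trans ENNReal.ofReal_lt_top).ne, ← hA]
    exact (ENNReal.ofReal_lt_ofReal_iff (by positivity)).2 (by linarith)
  have hsymm : upperGrowth e.symm < ENNReal.ofReal (B + ε) := by
    rw [← ENNReal.ofReal_toReal hwtop.ne, ← hB]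
    exact (ENNReal.ofReal_lt_ofReal_iff (by positivity)).2 (by linarith)
  obtain ⟨C₁, hC₁, hb₁⟩ := exists_abs_le_of_upperGrowth_lt hf' hderiv
  obtain ⟨C₂, hC₂, hb₂⟩ := exists_abs_le_of_upperGrowth_lt e.symm.continuous hsymm
  have hβ : 0 < A + ε := by positivity
  refine ⟨e, he, hwtop, ε, ε, (A + ε) * (B + ε), hε, hε, rfl, by positivity, hABε,
    (C₁ * (1 + (2 * C₂) ^ (A + ε)))⁻¹, K * (1 + (2 * C₂) ^ a), by positivity,
    mul_pos h.K_pos (by positivity), fun y => ⟨?_, ?_⟩⟩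
  · have h1 := hb₁ (e.symm y)
    rw [abs_of_pos (h.deriv_pos _)] at h1
    have h2 := rpow_le_of_le_one_add_rpow hC₂ hβ (hb₂ y)
    have h3 : 0 ≤ |y| ^ ((A + ε) * (B + ε)) := by positivity
    have h4 : 0 ≤ (2 * C₂) ^ (A + ε) := by positivity
    rw [inv_eq_one_div, div_div, ← one_div]
    refine one_div_le_one_div_of_le (h.deriv_pos _) (h1.trans ?_)
    rw [mul_assoc]
    refine mul_le_mul_of_nonneg_left ?_ hC₁.le
    nlinarith
  · have h1 := h.lower_bound (e.symm y)
    have h2 := rpow_le_of_le_one_add_rpow hC₂ h.a_pos (hb₂ y)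
    have h3 : 0 ≤ |y| ^ (a * (B + ε)) := by positivity
    have h4 : 0 ≤ (2 * C₂) ^ a := by positivity
    have h5 : 0 < K * (1 + |e.symm y| ^ a) := mul_pos h.K_pos (by positivity)
    rw [inv_eq_one_div]
    refine (one_div_le_one_div_of_le (one_div_pos.2 h5) h1).trans ?_
    rw [one_div_one_div, mul_assoc]
    refine mul_le_mul_of_nonneg_left ?_ h.K_pos.le
    nlinarith

/-! ### From derivative bounds to tail bounds -/

theorem exists_sub_eq_deriv_mul {w w' : ℝ → ℝ} (hw : ∀ y, HasDerivAt w (w' y) y) (y : ℝ) :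
    ∃ ξ, |ξ| ≤ |y| ∧ w y - w 0 = w' ξ * y := by
  have hc : Continuous w := continuous_iff_continuousAt.2 fun x => (hw x).continuousAt
  rcases lt_trichotomy y 0 with h | rfl | h
  · obtain ⟨ξ, hξ, h1⟩ := exists_hasDerivAt_eq_slope w w' h hc.continuousOn fun x _ => hw x
    refine ⟨ξ, ?_, ?_⟩
    · rw [abs_of_neg hξ.2, abs_of_neg h]; linarith [hξ.1]
    · rw [h1]; field_simp; ring
  · exact ⟨0, le_rfl, by simp⟩
  · obtain ⟨ξ, hξ, h1⟩ := exists_hasDerivAt_eq_slope w w' h hc.continuousOn fun x _ => hw x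
    refine ⟨ξ, ?_, ?_⟩
    · rw [abs_of_pos hξ.1, abs_of_pos h]; linarith [hξ.2]
    · rw [h1]; field_simp; ring

/-- Integrating polynomial bounds on the derivative of `w` gives polynomial bounds on `w ^ 2`,
which can be centred at any point `m`. -/
theorem exists_sq_bounds {w w' : ℝ → ℝ} {c C γ p : ℝ} (hw : ∀ y, HasDerivAt w (w' y) y)
    (hc : 0 < c) (hC : 0 < C) (hγ : 0 < γ) (hγ1 : γ < 1) (hp : 0 < p)
    (hlow : ∀ y, c / (1 + |y| ^ γ) ≤ w' y) (hup : ∀ y, w' y ≤ C * (1 + |y| ^ p)) (m : ℝ) :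
    ∃ c₂ c₃ c₄ : ℝ, 0 < c₂ ∧ 0 < c₃ ∧ ∀ y,
      c₃ * |y - m| ^ (2 * (1 - γ)) - c₄ ≤ w y ^ 2 ∧
      w y ^ 2 ≤ c₂ * (1 + |y - m| ^ (2 * (p + 1))) := by
  have hM : 0 < 1 + |m| := by positivity
  set M := 1 + |m| with hMdef
  set D := |w 0| + C * (1 + M ^ p) * M with hD
  have hDpos : 0 < D := by positivity
  set s := 2 * (1 - γ) with hs
  have hspos : 0 < s := by rw [hs]; linarith
  set L := (2 * M) ^ s with hL
  have hLpos : 0 < L := by positivity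
  refine ⟨(2 * D) ^ (2 : ℝ), c ^ 2 / (8 * L), c ^ 2 / 8 + (|w 0| + c / 2) ^ 2, by positivity,
    by positivity, fun y => ?_⟩
  obtain ⟨ξ, hξ, hy⟩ := exists_sub_eq_deriv_mul hw y
  have hw'pos : 0 < w' ξ := lt_of_lt_of_le (by positivity) (hlow ξ)
  have hyabs : |w y - w 0| = w' ξ * |y| := by rw [hy, abs_mul, abs_of_pos hw'pos]
  constructor
  · have h1 : c / (1 + |y| ^ γ) * |y| ≤ |w y| + |w 0| := by
      have h2 : c / (1 + |y| ^ γ) ≤ c / (1 + |ξ| ^ γ) := by gcongr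
      calc c / (1 + |y| ^ γ) * |y| ≤ w' ξ * |y| := by
            gcongr; exact h2.trans (hlow ξ)
        _ = |w y - w 0| := hyabs.symm
        _ ≤ |w y| + |w 0| := abs_sub _ _
    have h2 : c / 2 * |y| ^ (1 - γ) ≤ |w y| + (|w 0| + c / 2) := by
      rcases le_total |y| 1 with h | h
      · have h3 : |y| ^ (1 - γ) ≤ 1 := Real.rpow_le_one (abs_nonneg _) h (by linarith)
        have := abs_nonneg (w y)
        have := abs_nonneg (w 0)
        nlinarith
      · have h3 : 1 ≤ |y| ^ γ := Real.one_le_rpow h hγ.le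
        have h4 : |y| ^ (1 - γ) * |y| ^ γ = |y| := by
          rw [← Real.rpow_add (by linarith)]; simp
        have h5 : c / 2 * |y| ^ (1 - γ) ≤ c / (1 + |y| ^ γ) * |y| := by
          rw [div_mul_eq_mul_div, div_mul_eq_mul_div, div_le_div_iff₀ (by norm_num) (by positivity)]
          have h6 : 0 < |y| ^ (1 - γ) := by positivity
          have h7 : |y| ^ (1 - γ) * (1 + |y| ^ γ) ≤ 2 * |y| := by nlinarith
          nlinarith
        linarith
    have h3 : (|y| ^ (1 - γ)) ^ 2 = |y| ^ s := by
      rw [← Real.rpow_mul_natCast (abs_nonneg y), hs]; congr 1; push_cast; ring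
    have h4 : c ^ 2 / 8 * |y| ^ s ≤ w y ^ 2 + (|w 0| + c / 2) ^ 2 := by
      rw [← h3, ← sq_abs (w y)]
      have h5 : 0 ≤ c / 2 * |y| ^ (1 - γ) := by positivity
      have h6 := mul_self_le_mul_self h5 h2
      nlinarith [sq_nonneg (|w y| - (|w 0| + c / 2))]
    have h5 : |y - m| ≤ M * (1 + |y| ^ (1 : ℝ)) := by
      rw [Real.rpow_one, hMdef]
      have := abs_sub y m
      nlinarith [abs_nonneg m, abs_nonneg y]
    have h6 := rpow_le_of_le_one_add_rpow hM hspos h5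
    rw [mul_one, ← hL] at h6
    have h7 : c ^ 2 / (8 * L) * |y - m| ^ s ≤ c ^ 2 / 8 * (1 + |y| ^ s) := by
      calc c ^ 2 / (8 * L) * |y - m| ^ s ≤ c ^ 2 / (8 * L) * (L * (1 + |y| ^ s)) := by gcongr
        _ = c ^ 2 / 8 * (1 + |y| ^ s) := by field_simp
    nlinarith
  · set r := |y - m| with hr
    have hr0 : 0 ≤ r := abs_nonneg _
    set R := max 1 r with hR
    have hR1 : 1 ≤ R := le_max_left _ _
    have hRr : r ≤ R := le_max_right _ _
    have hyR : |y| ≤ M * R := by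
      have h1 : |y| ≤ r + |m| := by
        have := abs_add_le (y - m) m
        rwa [sub_add_cancel] at this
      rw [hMdef]
      nlinarith [abs_nonneg m]
    have h1 : w' ξ ≤ C * (1 + M ^ p) * R ^ p := by
      refine (hup ξ).trans ?_
      have h2 : |ξ| ^ p ≤ M ^ p * R ^ p := by
        rw [← Real.mul_rpow hM.le (by linarith)]
        exact Real.rpow_le_rpow (abs_nonneg _) (hξ.trans hyR) hp.le
      have h3 : 1 ≤ R ^ p := Real.one_le_rpow hR1 hp.le
      rw [mul_assoc]
      refine mul_le_mul_of_nonneg_left ?_ hC.le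
      nlinarith
    have h2 : |w y| ≤ D * R ^ (p + 1) := by
      have h3 : |w y| ≤ |w y - w 0| + |w 0| := by
        have := abs_add_le (w y - w 0) (w 0)
        rwa [sub_add_cancel] at this
      have h4 : w' ξ * |y| ≤ C * (1 + M ^ p) * R ^ p * (M * R) := by gcongr
      have h5 : R ^ (p + 1) = R ^ p * R := by rw [Real.rpow_add (by linarith), Real.rpow_one]
      have h6 : 1 ≤ R ^ (p + 1) := Real.one_le_rpow hR1 (by linarith)
      rw [hyabs] at h3
      rw [hD, add_mul]
      have h7 : |w 0| ≤ |w 0| * R ^ (p + 1) := le_mul_of_one_le_right (abs_nonneg _) h6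
      have h8 : C * (1 + M ^ p) * R ^ p * (M * R) = C * (1 + M ^ p) * M * R ^ (p + 1) := by
        rw [h5]; ring
      linarith
    have h3 : R ^ (p + 1) ≤ 1 + r ^ (p + 1) := by
      have : 0 ≤ r ^ (p + 1) := by positivity
      rcases max_cases 1 r with ⟨h, _⟩ | ⟨h, _⟩ <;> rw [hR, h]
      · rw [Real.one_rpow]; linarith
      · linarith
    have h4 : |w y| ≤ D * (1 + |r| ^ (p + 1)) := by
      rw [abs_of_nonneg hr0]
      exact h2.trans (by gcongr)
    have h5 := rpow_le_of_le_one_add_rpow hDpos two_pos h4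
    rwa [abs_of_nonneg hr0, Real.rpow_two, sq_abs] at h5

theorem one_add_rpow_le {x p q : ℝ} (hx : 0 ≤ x) (hp : 0 ≤ p) (hpq : p ≤ q) :
    1 + x ^ p ≤ 2 * (1 + x ^ q) := by
  have h0 : 0 ≤ x ^ q := by positivity
  rcases le_total x 1 with h | h
  · have := Real.rpow_le_one hx h hp
    linarith
  · have := Real.rpow_le_rpow_of_exponent_le h hpq
    linarith

/-- Tail bounds with the exponents of the two-sided estimate on `-log ρ`. First `C₁` is
chosen small, uniformly over large `C₂`, and then `C₂` is chosen large in terms of `C₁`. -/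
theorem exists_tailBounds_explicit {ρ u : ℝ → ℝ} {m A t γ p c₀ c₁ c₂ c₃ c₄ : ℝ} (ht : 0 < t)
    (hA : 0 < A) (hγ1 : γ < 1) (hp : 0 < p) (hc₀ : 0 < c₀) (hc₁ : 0 < c₁)
    (hc₂ : 0 < c₂) (hc₃ : 0 < c₃)
    (hlow : ∀ y, c₀ / (1 + |y| ^ γ) * Real.exp (-u y) ≤ ρ y)
    (hup : ∀ y, ρ y ≤ c₁ * (1 + |y| ^ p) * Real.exp (-u y))
    (hulow : ∀ y, c₃ * |y - m| ^ (2 * (1 - γ)) - c₄ ≤ u y)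
    (huup : ∀ y, u y ≤ c₂ * (1 + |y - m| ^ (2 * (p + 1)))) :
    ∃ y₀ C₁ C₂ : ℝ, 0 < y₀ ∧ 0 < C₁ ∧ 0 < C₂ ∧
      TailBounds ρ m A t y₀ C₁ C₁ C₂ (2 * (1 - γ)) p := by
  set s := 2 * (1 - γ) with hs
  have hs0 : 0 < s := by rw [hs]; linarith
  set q := 2 * (p + 1) with hq
  set B := |(1 : ℝ) - m| with hB
  set E := 2 * B ^ 2 / t * (1 + (1 : ℝ) ^ (2 * p)) with hE
  have hE0 : 0 ≤ E := by positivity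
  obtain ⟨C₁, hC₁, hC₁a, hC₁b⟩ : ∃ C₁ : ℝ, 0 < C₁ ∧ C₁ ≤ 1 / (c₂ * (p + 1) * t) ∧
      C₁ ≤ A * Real.exp (-E) / (t * (2 * c₁ * Real.exp c₄)) :=
    ⟨min (1 / (c₂ * (p + 1) * t)) (A * Real.exp (-E) / (t * (2 * c₁ * Real.exp c₄))),
      lt_min (by positivity) (by positivity), min_le_left _ _, min_le_right _ _⟩
  obtain ⟨C₂, hC₂a, hC₂b, hC₂c⟩ : ∃ C₂ : ℝ, 1 ≤ C₂ ∧ 1 / (s * c₃ * t) ≤ C₂ ∧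
      A / (t * c₀) * Real.exp (c₂ + B ^ q / ((p + 1) * C₁ * t)) ≤ C₂ :=
    ⟨max 1 (max (1 / (s * c₃ * t)) (A / (t * c₀) * Real.exp (c₂ + B ^ q / ((p + 1) * C₁ * t)))),
      le_max_left _ _, (le_max_left _ _).trans (le_max_right _ _),
      (le_max_right _ _).trans (le_max_right _ _)⟩
  have hC₂ : 0 < C₂ := by linarith
  refine ⟨1, C₁, C₂, one_pos, hC₁, hC₂, fun y _ => ?_⟩
  rw [← hB, ← hq]
  have hr : 0 ≤ |y - m| := abs_nonneg _
  constructor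
  · refine le_trans ?_ (hlow y)
    have h1 : A / (C₂ * t) ≤ c₀ * Real.exp (-(c₂ + B ^ q / ((p + 1) * C₁ * t))) := by
      rw [Real.exp_neg, ← div_eq_mul_inv, div_le_div_iff₀ (by positivity) (by positivity)]
      rw [div_mul_eq_mul_div, div_le_iff₀ (by positivity)] at hC₂c
      linarith
    have h2 : c₂ * |y - m| ^ q ≤ |y - m| ^ q / ((p + 1) * C₁ * t) := by
      rw [le_div_iff₀ (by positivity)]
      rw [le_div_iff₀ (by positivity)] at hC₁a
      have : 0 ≤ |y - m| ^ q := by positivity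
      nlinarith
    have h3 : Real.exp (-((|y - m| ^ q - B ^ q) / ((p + 1) * C₁ * t)))
        ≤ Real.exp (B ^ q / ((p + 1) * C₁ * t) + c₂ - u y) := by
      refine Real.exp_le_exp.2 ?_
      have := huup y
      rw [sub_div]
      linarith
    have hg : 1 - s / 2 = γ := by rw [hs]; ring
    rw [hg]
    have h5 : 0 < 1 + |y| ^ γ := by positivity
    calc A / (C₂ * t * (1 + |y| ^ γ))
          * Real.exp (-((|y - m| ^ q - B ^ q) / ((p + 1) * C₁ * t)))
        = A / (C₂ * t) * Real.exp (-((|y - m| ^ q - B ^ q) / ((p + 1) * C₁ * t)))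
            / (1 + |y| ^ γ) := by field_simp
      _ ≤ c₀ * Real.exp (-(c₂ + B ^ q / ((p + 1) * C₁ * t)))
            * Real.exp (B ^ q / ((p + 1) * C₁ * t) + c₂ - u y) / (1 + |y| ^ γ) := by gcongr
      _ = c₀ / (1 + |y| ^ γ) * Real.exp (-u y) := by
          rw [mul_assoc, ← Real.exp_add]; ring_nf
  · refine (hup y).trans ?_
    have h1 : 2 * c₁ * Real.exp c₄ ≤ A / (C₁ * t) * Real.exp (-E) := by
      rw [div_mul_eq_mul_div, le_div_iff₀ (by positivity)]
      rw [le_div_iff₀ (by positivity)] at hC₁b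
      linarith
    have h2 : Real.exp (-E) ≤ Real.exp (-(2 * B ^ 2 / (C₂ * t) * (1 + (1 : ℝ) ^ (2 * p)))) := by
      refine Real.exp_le_exp.2 (neg_le_neg ?_)
      rw [hE]
      gcongr
      nlinarith
    have h3 : Real.exp (-u y) ≤ Real.exp c₄ *
        Real.exp (-((|y - m| ^ s - B ^ s) / (s * C₂ * t))) := by
      rw [← Real.exp_add]
      refine Real.exp_le_exp.2 ?_
      have h4 := hulow y
      have h5 : |y - m| ^ s / (s * C₂ * t) ≤ c₃ * |y - m| ^ s := by
        rw [div_le_iff₀ (by positivity)]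
        rw [div_le_iff₀ (by positivity)] at hC₂b
        have : 0 ≤ |y - m| ^ s := by positivity
        nlinarith
      have h6 : 0 ≤ B ^ s / (s * C₂ * t) := by positivity
      rw [sub_div]
      linarith
    have h4 := one_add_rpow_le (abs_nonneg y) hp.le (by linarith : p ≤ 2 * p)
    calc c₁ * (1 + |y| ^ p) * Real.exp (-u y)
        ≤ c₁ * (2 * (1 + |y| ^ (2 * p))) * (Real.exp c₄ *
          Real.exp (-((|y - m| ^ s - B ^ s) / (s * C₂ * t)))) := by gcongr
      _ = (2 * c₁ * Real.exp c₄) * (1 + |y| ^ (2 * p)) *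
          Real.exp (-((|y - m| ^ s - B ^ s) / (s * C₂ * t))) := by ring
      _ ≤ (A / (C₁ * t) * Real.exp (-(2 * B ^ 2 / (C₂ * t) * (1 + (1 : ℝ) ^ (2 * p)))))
          * (1 + |y| ^ (2 * p)) * Real.exp (-((|y - m| ^ s - B ^ s) / (s * C₂ * t))) := by
          have h5 := h1.trans (mul_le_mul_of_nonneg_left h2 (by positivity : 0 ≤ A / (C₁ * t)))
          gcongr
      _ = _ := by ring

set_option maxHeartbeats 1000000 in
/-- Tail bounds with the same constant in both exponentials. The exponent `p₂ = n` is taken large and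
`C₂` is tuned so that the exponential of the lower bound is `exp (1 - (r / B) ^ q)`, with
`r = |y - m|`, `B = |y₀ - m|` and `q = 2 * (n + 1)`; the prefactor is then of order `n / B ^ q`,
hence arbitrarily small. The exponent `p₁` is taken so small that the upper bound holds for every
value of `C₂`. -/
theorem exists_tailBounds {ρ u : ℝ → ℝ} {m A t γ p c₀ c₁ c₂ c₃ c₄ : ℝ} (ht : 0 < t)
    (hA : 0 < A) (hγ : 0 < γ) (hγ1 : γ < 1) (hp : 0 < p) (hc₀ : 0 < c₀) (hc₁ : 0 < c₁)
    (hc₂ : 0 < c₂) (hc₃ : 0 < c₃)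
    (hlow : ∀ y, c₀ / (1 + |y| ^ γ) * Real.exp (-u y) ≤ ρ y)
    (hup : ∀ y, ρ y ≤ c₁ * (1 + |y| ^ p) * Real.exp (-u y))
    (hulow : ∀ y, c₃ * |y - m| ^ (2 * (1 - γ)) - c₄ ≤ u y)
    (huup : ∀ y, u y ≤ c₂ * (1 + |y - m| ^ (2 * (p + 1)))) :
    ∃ y₀ C₁ C₂ p₁ p₂ : ℝ, 0 < y₀ ∧ 0 < C₁ ∧ 0 < C₂ ∧ 0 < p₁ ∧ p₁ < 2 ∧ 0 < p₂ ∧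
      TailBounds ρ m A t y₀ C₂ C₁ C₂ p₁ p₂ := by
  set y₀ := |m| + 2 with hy₀
  have hy₀1 : 1 ≤ y₀ := by have := abs_nonneg m; linarith
  set B := |y₀ - m| with hB
  have hB2 : 2 ≤ B := by
    rw [hB, hy₀]
    exact le_trans (by linarith [le_abs_self m]) (le_abs_self _)
  have hB0 : 0 < B := by linarith
  set q₀ := 2 * (p + 1) with hq₀
  -- With `x = r / B` the bound on `u` reads `c₂ + b * x ^ q₀`; since `2 * q₀ ≤ q`, it is at most
  -- `x ^ q` plus a constant that does not depend on `n`.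
  set b := c₂ * B ^ q₀ with hb
  obtain ⟨n, hn⟩ := exists_nat_ge (max (2 * (p + 1)) (A * Real.exp (c₂ + 2 + b ^ 2 / 4) / c₀))
  have hn1 : 2 * (p + 1) ≤ n := (le_max_left _ _).trans hn
  have hn2 : A * Real.exp (c₂ + 2 + b ^ 2 / 4) / c₀ ≤ n := (le_max_right _ _).trans hn
  have hn0 : (0 : ℝ) < n := by linarith
  set q := 2 * ((n : ℝ) + 1) with hq
  have hBq0 : 0 < B ^ q := by positivity
  have hBq : ((n : ℝ) + 1) ^ 2 ≤ B ^ q := by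
    have h1 : ((n : ℝ) + 1) ≤ 2 ^ (n + 1) := by
      exact_mod_cast (Nat.lt_two_pow_self (n := n + 1)).le
    have h2 : B ^ q = (B ^ (n + 1)) ^ 2 := by
      rw [← pow_mul, ← Real.rpow_natCast, hq]; congr 1; push_cast; ring
    rw [h2]
    have h3 : (2 : ℝ) ^ (n + 1) ≤ B ^ (n + 1) := by gcongr
    gcongr
    exact h1.trans h3
  set C₂ := B ^ q / (((n : ℝ) + 1) * t) with hC₂def
  have hC₂ : 0 < C₂ := by positivity
  have hC₂t : ((n : ℝ) + 1) * C₂ * t = B ^ q := by rw [hC₂def]; field_simp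
  set s := 1 - γ with hs
  have hs0 : 0 < s := by rw [hs]; linarith
  set k := 1 / (s * C₂ * t) with hk
  set E := 2 * B ^ 2 / (C₂ * t) * (1 + y₀ ^ (2 * (n : ℝ))) with hE
  set C₁ := A * Real.exp (-E) / (2 * c₁ * t * Real.exp (c₄ + k ^ 2 / (4 * c₃))) with hC₁def
  have hC₁ : 0 < C₁ := by positivity
  refine ⟨y₀, C₁, C₂, s, n, by linarith, hC₁, hC₂, hs0, by rw [hs]; linarith, hn0,
    fun y hy => ?_⟩
  have hy1 : 1 ≤ |y| := by linarith
  rw [← hB, ← hq, hC₂t]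
  set r := |y - m| with hr
  have hr0 : 0 ≤ r := abs_nonneg _
  constructor
  · refine le_trans ?_ (hlow y)
    set x := r / B with hx
    have hx0 : 0 ≤ x := by positivity
    have h1 : (r ^ q - B ^ q) / B ^ q = x ^ q - 1 := by
      rw [sub_div, div_self hBq0.ne', hx, Real.div_rpow hr0 hB0.le]
    have h2 : u y ≤ c₂ + (b ^ 2 / 4 + (1 + x ^ q)) := by
      have h3 := huup y
      have h4 : c₂ * r ^ q₀ = b * x ^ q₀ := by
        rw [hb, hx, Real.div_rpow hr0 hB0.le]; field_simp
      have h5 : (x ^ q₀) ^ 2 ≤ 1 + x ^ q := by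
        rw [← Real.rpow_mul_natCast hx0]
        rcases le_total x 1 with h | h
        · have h6 : x ^ (q₀ * (2 : ℕ)) ≤ 1 := Real.rpow_le_one hx0 h (by positivity)
          have h7 : 0 ≤ x ^ q := by positivity
          linarith
        · have h6 : x ^ (q₀ * (2 : ℕ)) ≤ x ^ q := by
            refine Real.rpow_le_rpow_of_exponent_le h ?_
            rw [hq₀, hq]; push_cast; linarith
          linarith
      nlinarith [sq_nonneg (b / 2 - x ^ q₀)]
    have h3 : A / (C₂ * t) ≤ c₀ * Real.exp (-(c₂ + 2 + b ^ 2 / 4)) := by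
      have h4 : A / (C₂ * t) = A * ((n : ℝ) + 1) / B ^ q := by rw [← hC₂t]; field_simp
      rw [h4, Real.exp_neg, ← div_eq_mul_inv, div_le_div_iff₀ hBq0 (by positivity)]
      rw [div_le_iff₀ hc₀] at hn2
      calc A * ((n : ℝ) + 1) * Real.exp (c₂ + 2 + b ^ 2 / 4)
          = A * Real.exp (c₂ + 2 + b ^ 2 / 4) * ((n : ℝ) + 1) := by ring
        _ ≤ n * c₀ * ((n : ℝ) + 1) := by gcongr
        _ ≤ c₀ * ((n : ℝ) + 1) ^ 2 := by nlinarith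
        _ ≤ c₀ * B ^ q := by gcongr
    have h4 : |y| ^ γ ≤ |y| ^ (1 - s / 2) := by
      refine Real.rpow_le_rpow_of_exponent_le hy1 ?_
      rw [hs]; linarith
    have h5 : 0 < 1 + |y| ^ γ := by positivity
    rw [h1]
    calc A / (C₂ * t * (1 + |y| ^ (1 - s / 2))) * Real.exp (-(x ^ q - 1))
        ≤ A / (C₂ * t * (1 + |y| ^ γ)) * Real.exp (-(x ^ q - 1)) := by gcongr
      _ = A / (C₂ * t) * Real.exp (-(x ^ q - 1)) / (1 + |y| ^ γ) := by field_simp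
      _ ≤ c₀ * Real.exp (-(c₂ + 2 + b ^ 2 / 4)) * Real.exp (-(x ^ q - 1)) / (1 + |y| ^ γ) := by
          gcongr
      _ = c₀ / (1 + |y| ^ γ) *
          Real.exp (-(c₂ + 2 + b ^ 2 / 4) + -(x ^ q - 1)) := by
          rw [Real.exp_add]; ring
      _ ≤ c₀ / (1 + |y| ^ γ) * Real.exp (-u y) := by
          gcongr
          linarith
  · refine (hup y).trans ?_
    have h1 : 2 * c₁ * Real.exp (c₄ + k ^ 2 / (4 * c₃)) = A / (C₁ * t) * Real.exp (-E) := by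
      rw [hC₁def]; field_simp
    have h3 : Real.exp (-u y) ≤ Real.exp (c₄ + k ^ 2 / (4 * c₃)) *
        Real.exp (-((r ^ s - B ^ s) / (s * C₂ * t))) := by
      rw [← Real.exp_add]
      refine Real.exp_le_exp.2 ?_
      have h4 := hulow y
      have h5 : r ^ (2 * s) = (r ^ s) ^ 2 := by
        rw [← Real.rpow_mul_natCast hr0]; congr 1; push_cast; ring
      rw [← hr, h5] at h4
      have h6 : 0 ≤ B ^ s / (s * C₂ * t) := by positivity
      have h7 : r ^ s / (s * C₂ * t) = k * r ^ s := by rw [hk]; ring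
      have h8 : k * r ^ s ≤ c₃ * (r ^ s) ^ 2 + k ^ 2 / (4 * c₃) := by
        have h9 : c₃ * (r ^ s) ^ 2 + k ^ 2 / (4 * c₃) - k * r ^ s
            = c₃ * (r ^ s - k / (2 * c₃)) ^ 2 := by field_simp; ring
        linarith [mul_nonneg hc₃.le (sq_nonneg (r ^ s - k / (2 * c₃)))]
      rw [sub_div]
      linarith
    have h4 := one_add_rpow_le (abs_nonneg y) hp.le (by linarith : p ≤ 2 * (n : ℝ))
    calc c₁ * (1 + |y| ^ p) * Real.exp (-u y)
        ≤ c₁ * (2 * (1 + |y| ^ (2 * (n : ℝ)))) * (Real.exp (c₄ + k ^ 2 / (4 * c₃)) *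
          Real.exp (-((r ^ s - B ^ s) / (s * C₂ * t)))) := by gcongr
      _ = (2 * c₁ * Real.exp (c₄ + k ^ 2 / (4 * c₃))) * (1 + |y| ^ (2 * (n : ℝ))) *
          Real.exp (-((r ^ s - B ^ s) / (s * C₂ * t))) := by ring
      _ = _ := by rw [h1]; ring

/-! ### Images of a Gaussian variable -/

theorem gaussianReal_map_eq_withDensity {f : ℝ → ℝ} (hf : Differentiable ℝ f)
    (hpos : ∀ x, 0 < deriv f x) (e : ℝ ≃o ℝ) (he : ∀ x, e x = f x) {t : ℝ≥0} (ht : t ≠ 0) :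
    (gaussianReal 0 t).map f = volume.withDensity
      (fun y => ENNReal.ofReal ((deriv f (e.symm y))⁻¹ * gaussianPDFReal 0 t (e.symm y))) := by
  have hw : ∀ y, HasDerivAt e.symm (deriv f (e.symm y))⁻¹ y := fun y =>
    (hf (e.symm y)).hasDerivAt.of_local_left_inverse e.symm.continuous.continuousAt (hpos _).ne'
      (Eventually.of_forall fun z => by rw [← he, e.apply_symm_apply])
  ext s hs
  rw [Measure.map_apply hf.continuous.measurable hs, withDensity_apply _ hs,
    gaussianReal_apply _ ht]
  have himg : f ⁻¹' s = e.symm '' s := by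
    have : f = e := funext fun x => (he x).symm
    rw [this]
    exact (e.symm.toEquiv.image_eq_preimage_symm s).symm
  rw [himg, lintegral_image_eq_lintegral_abs_deriv_mul hs (fun y _ => (hw y).hasDerivWithinAt)
    e.symm.injective.injOn]
  refine lintegral_congr fun y => ?_
  rw [abs_of_pos (inv_pos.2 (hpos _)), gaussianPDF, ENNReal.ofReal_mul (inv_pos.2 (hpos _)).le]

theorem integrable_comp_gaussianReal {f : ℝ → ℝ} (hf : Differentiable ℝ f)
    (hf' : Continuous (deriv f)) (h : upperGrowth (deriv f) < ⊤) (t : ℝ≥0) :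
    Integrable f (gaussianReal 0 t) := by
  obtain ⟨n, hn⟩ := ENNReal.exists_nat_gt h.ne
  rw [← ENNReal.ofReal_natCast] at hn
  obtain ⟨C, hC, hb⟩ := exists_abs_le_of_upperGrowth_lt hf' hn
  have h1 : Integrable (fun x : ℝ => ‖id x‖ ^ 1) (gaussianReal 0 t) :=
    (memLp_id_gaussianReal' ((1 : ℕ) : ℝ≥0∞) (by simp)).integrable_norm_pow (by simp)
  have h2 : Integrable (fun x : ℝ => ‖id x‖ ^ (n + 1)) (gaussianReal 0 t) :=
    (memLp_id_gaussianReal' ((n + 1 : ℕ) : ℝ≥0∞) (ENNReal.natCast_ne_top _)).integrable_norm_pow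
      (by simp)
  refine (((integrable_const |f 0|).add ((h1.const_mul C).add (h2.const_mul C)))).mono'
    hf.continuous.aestronglyMeasurable (Eventually.of_forall fun x => ?_)
  obtain ⟨ξ, hξ, hx⟩ := exists_sub_eq_deriv_mul (fun y => (hf y).hasDerivAt) x
  have h3 : |f x| ≤ |f x - f 0| + |f 0| := by
    have := abs_add_le (f x - f 0) (f 0)
    rwa [sub_add_cancel] at this
  have h4 : |deriv f ξ| ≤ C * (1 + |x| ^ n) := by
    refine (hb ξ).trans ?_
    rw [Real.rpow_natCast]
    gcongr
  have h5 : |f x - f 0| ≤ C * (1 + |x| ^ n) * |x| := by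
    rw [hx, abs_mul]; gcongr
  simp only [Pi.add_apply, id, Real.norm_eq_abs, pow_succ]
  linarith

/-- The mean absolute deviation is positive, since a law with a density is not a point mass. -/
theorem integral_abs_sub_pos {Ω : Type*} [MeasurableSpace Ω] {P : Measure Ω}
    [IsProbabilityMeasure P] {X : Ω → ℝ} (hX : Integrable X P) {ρ : ℝ → ℝ≥0∞}
    (hρ : P.map X = volume.withDensity ρ) (m : ℝ) : 0 < ∫ ω, |X ω - m| ∂P := by
  have h0 : 0 ≤ ∫ ω, |X ω - m| ∂P := integral_nonneg fun ω => abs_nonneg _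
  refine lt_of_le_of_ne h0 fun h => ?_
  have hint : Integrable (fun ω => |X ω - m|) P := (hX.sub (integrable_const m)).abs
  have h1 := (integral_eq_zero_iff_of_nonneg (fun ω => abs_nonneg _) hint).1 h.symm
  have h2 : P (X ⁻¹' {m}) = 0 := by
    rw [← Measure.map_apply_of_aemeasurable hX.aemeasurable (measurableSet_singleton m), hρ]
    exact withDensity_absolutelyContinuous _ _ (measure_singleton m)
  have h3 : ∀ᵐ ω ∂P, ω ∉ X ⁻¹' {m} := measure_eq_zero_iff_ae_notMem.1 h2
  have h4 : ∀ᵐ _ω ∂P, False := by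
    filter_upwards [h1, h3] with ω h1 h3
    exact h3 (by simpa [sub_eq_zero] using h1)
  simp only [eventually_false_iff_eq_bot, ae_eq_bot] at h4
  exact IsProbabilityMeasure.ne_zero P h4

/-- The tail estimates hold for any image `f (G)` of a centred Gaussian variable `G` under a function
that satisfies the growth assumptions. -/
theorem hasTailEstimates_of_hasLaw {Ω : Type*} [MeasurableSpace Ω] {P : Measure Ω}
    [IsProbabilityMeasure P] {X G : Ω → ℝ} {t : ℝ≥0} (ht : 0 < t)
    (hG : HasLaw G (gaussianReal 0 t) P) {f : ℝ → ℝ} {K a : ℝ} (hX : ∀ᵐ ω ∂P, X ω = f (G ω))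
    (hf : Differentiable ℝ f) (hf' : Continuous (deriv f)) (h : TailAssumptions f K a) :
    HasTailEstimates P X t f a := by
  have htR : (0 : ℝ) < t := ht
  have hgrowth : upperGrowth (deriv f) < ⊤ := h.growth_lt.trans h.growth_lt_top
  have hmap : P.map X = (gaussianReal 0 t).map f := by
    rw [Measure.map_congr hX, ← hG.map_eq,
      AEMeasurable.map_map_of_aemeasurable hf.continuous.measurable.aemeasurable hG.aemeasurable]
    rfl
  have hXint : Integrable X P := by
    have h1 := integrable_comp_gaussianReal hf hf' hgrowth t
    rw [← hG.map_eq] at h1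
    exact (h1.comp_aemeasurable hG.aemeasurable).congr (hX.mono fun ω hω => hω.symm)
  obtain ⟨e, he, hwtop, ε, ε', γ, hε, hε', hγ, hγ0, hγ1, c, C, hc, hC, hb⟩ :=
    exists_orderIso_of_tailAssumptions hf hf' h
  have hdens := gaussianReal_map_eq_withDensity hf h.deriv_pos e he ht.ne'
  set w' : ℝ → ℝ := fun y => (deriv f (e.symm y))⁻¹ with hw'
  have hw : ∀ y, HasDerivAt e.symm (w' y) y := fun y =>
    (hf (e.symm y)).hasDerivAt.of_local_left_inverse e.symm.continuous.continuousAt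
      (h.deriv_pos _).ne' (Eventually.of_forall fun z => by rw [← he, e.apply_symm_apply])
  set p := a * ((upperGrowth e.symm).toReal + ε') with hp
  have hp0 : 0 < p := mul_pos h.a_pos (add_pos_of_nonneg_of_pos ENNReal.toReal_nonneg hε')
  set m := ∫ ω, X ω ∂P with hm
  set A := ∫ ω, |X ω - m| ∂P with hA
  rw [hdens] at hmap
  have hA0 : 0 < A := integral_abs_sub_pos hXint hmap m
  set ρ : ℝ → ℝ := fun y => w' y * gaussianPDFReal 0 t (e.symm y) with hρ
  set u : ℝ → ℝ := fun y => e.symm y ^ 2 / (2 * t) with hu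
  set g := (√(2 * Real.pi * t))⁻¹ with hg
  have hg0 : 0 < g := by positivity
  have hρu : ∀ y, ρ y = g * w' y * Real.exp (-u y) := by
    intro y
    simp only [hρ, gaussianPDFReal, sub_zero, hu, ← hg, neg_div]
    ring
  obtain ⟨d₂, d₃, d₄, hd₂, hd₃, hd⟩ := exists_sq_bounds hw hc hC hγ0 hγ1 hp0
    (fun y => (hb y).1) (fun y => (hb y).2) m
  have hlow : ∀ y, g * c / (1 + |y| ^ γ) * Real.exp (-u y) ≤ ρ y := by
    intro y
    rw [hρu, mul_div_assoc]
    have := (hb y).1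
    gcongr
  have hup : ∀ y, ρ y ≤ g * C * (1 + |y| ^ p) * Real.exp (-u y) := by
    intro y
    rw [hρu, mul_assoc g C]
    have := (hb y).2
    gcongr
  have hulow : ∀ y, d₃ / (2 * t) * |y - m| ^ (2 * (1 - γ)) - d₄ / (2 * t) ≤ u y := by
    intro y
    change _ ≤ e.symm y ^ 2 / (2 * t)
    rw [div_mul_eq_mul_div, ← sub_div]
    have := (hd y).1
    gcongr
  have huup : ∀ y, u y ≤ d₂ / (2 * t) * (1 + |y - m| ^ (2 * (p + 1))) := by
    intro y
    change e.symm y ^ 2 / (2 * t) ≤ _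
    rw [div_mul_eq_mul_div]
    have := (hd y).2
    gcongr
  have hcont : Continuous ρ := by
    simp only [hρ, hw', gaussianPDFReal]
    refine ((hf'.comp e.symm.continuous).inv₀ fun y => (h.deriv_pos _).ne').mul ?_
    have := e.symm.continuous
    fun_prop
  refine ⟨hXint, ρ, hcont, fun y => ?_, hmap, ?_, e.symm, fun x => ?_, fun y => ?_, hwtop,
    ε, ε', γ, 2 * (1 - γ), p, hε, hε', hγ, hγ0, hγ1, rfl, rfl, hp0, ?_⟩
  · exact mul_nonneg (inv_nonneg.2 (h.deriv_pos _).le) (gaussianPDFReal_nonneg _ _ _)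
  · exact exists_tailBounds htR hA0 hγ0 hγ1 hp0 (by positivity) (by positivity) (by positivity)
      (by positivity) hlow hup hulow huup
  · rw [← he, e.symm_apply_apply]
  · rw [← he, e.apply_symm_apply]
  · exact exists_tailBounds_explicit htR hA0 hγ1 hp0 (by positivity) (by positivity)
      (by positivity) (by positivity) hlow hup hulow huup

/-! ### Brownian motion relative to the augmented filtration -/

/-- `W` is a Brownian motion relative to the filtration `𝓕`: it is adapted and almost surely
continuous, and its increments after time `s` are centred Gaussian and independent of `𝓕 s`. -/
structure IsBrownianWrt {Ω : Type*} {mΩ : MeasurableSpace Ω} (P : Measure Ω)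
    (𝓕 : Filtration ℝ≥0 mΩ) (W : ℝ≥0 → Ω → ℝ) : Prop where
  adapted : ∀ t, Measurable[𝓕 t] (W t)
  indep : ∀ s u, s ≤ u →
    Indep (𝓕 s) (MeasurableSpace.comap (fun ω => W u ω - W s ω) inferInstance) P
  law : ∀ s u, s ≤ u → HasLaw (fun ω => W u ω - W s ω) (gaussianReal 0 (u - s)) P
  cont : ∀ᵐ ω ∂P, Continuous fun t => W t ω

theorem indep_sup_nullEvents {Ω : Type*} {m m' mΩ : MeasurableSpace Ω} {P : Measure Ω}
    (h : Indep m m' P) : Indep (m ⊔ nullEvents P) m' P := by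
  have hle : m ⊔ nullEvents P ≤ eventuallyMeasurableSpace m (ae P) := by
    refine sup_le le_eventuallyMeasurableSpace (MeasurableSpace.generateFrom_le ?_)
    rintro A ⟨-, hA⟩
    exact ⟨∅, @MeasurableSet.empty _ m, ae_eq_empty.2 hA⟩
  rw [Indep_iff] at h ⊢
  intro A B hA hB
  obtain ⟨A', hA', hAA'⟩ := hle A hA
  rw [measure_congr hAA', measure_congr (hAA'.inter (ae_eq_refl B)), h A' B hA' hB]

section

variable {Ω : Type*} {mΩ : MeasurableSpace Ω} {P : Measure Ω} {W : ℝ≥0 → Ω → ℝ}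

theorem indep_natural_increment (hWm : ∀ t, Measurable (W t)) (hW : IsPreBrownianReal W P)
    {r u : ℝ≥0} (hru : r ≤ u) :
    Indep (Filtration.natural W (fun t => (hWm t).stronglyMeasurable) r)
      (MeasurableSpace.comap (fun ω => W u ω - W r ω) inferInstance) P := by
  have h1 := (hW.indepFun_shift r).comp (measurable_pi_apply (u - r)) measurable_id
  have h2 : ((fun x : ℝ≥0 → ℝ => x (u - r)) ∘ fun ω t => W (r + t) ω - W r ω)
      = fun ω => W u ω - W r ω := by
    funext ω
    simp [add_tsub_cancel_of_le hru]
  rw [Filtration.natural_eq_comap]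
  rw [h2] at h1
  exact h1.symm

/-- Completion and right-continuous regularization of the natural filtration do not destroy the
independence of future increments: the increments after `r > s` are independent of `𝓕 s`, and
`r` can be sent to `s` by continuity of the paths. -/
theorem isBrownianWrt_augmentedFiltration [IsProbabilityMeasure P] (hWm : ∀ t, Measurable (W t))
    (hW : IsBrownianReal W P) : IsBrownianWrt P (augmentedFiltration P W hWm) W where
  adapted t := by
    have h1 : Measurable[Filtration.natural W (fun t => (hWm t).stronglyMeasurable) t] (W t) :=
      (Filtration.stronglyAdapted_natural fun t => (hWm t).stronglyMeasurable) t |>.measurable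
    refine h1.mono ?_ le_rfl
    refine le_trans ?_ (Filtration.le_rightCont _ t)
    exact le_sup_left (a := Filtration.natural W (fun t => (hWm t).stronglyMeasurable) t)
  indep s u hsu := by
    rcases hsu.eq_or_lt with rfl | hsu
    · have : (fun ω => W s ω - W s ω) = fun _ => (0 : ℝ) := by simp
      rw [this, MeasurableSpace.comap_const]
      exact indep_bot_right _
    refine indep_comap_of_bcf (Filtration.le _ s) ((hWm u).sub (hWm s)).aemeasurable
      fun A hA φ => ?_
    obtain ⟨r, -, hr, hrlim⟩ := exists_seq_strictAnti_tendsto' hsu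
    have hstep : ∀ n, ∫ ω in A, φ (W u ω - W (r n) ω) ∂P
        = P.real A * ∫ ω, φ (W u ω - W (r n) ω) ∂P := by
      intro n
      have hAn : MeasurableSet[Filtration.natural W (fun t => (hWm t).stronglyMeasurable) (r n)
          ⊔ nullEvents P] A := by
        rw [augmentedFiltration, Filtration.rightCont_eq] at hA
        exact MeasurableSpace.measurableSet_iInf.1
          (MeasurableSpace.measurableSet_iInf.1 hA (r n)) (hr n).1
      exact (indep_sup_nullEvents
        (indep_natural_increment hWm hW.toIsPreBrownianReal (hr n).2.le)).setIntegral_eq_mul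
        (sup_le (Filtration.le _ _) (nullEvents_le P)) ((hWm u).sub (hWm (r n))).aemeasurable hAn
        φ.continuous.aestronglyMeasurable
    have hlim : ∀ Q : Measure Ω, IsFiniteMeasure Q → Q ≪ P →
        Tendsto (fun n => ∫ ω, φ (W u ω - W (r n) ω) ∂Q) atTop
          (𝓝 (∫ ω, φ (W u ω - W s ω) ∂Q)) := by
      intro Q hQ hQP
      refine tendsto_integral_of_dominated_convergence (fun _ => ‖φ‖) (fun n => ?_)
        (integrable_const _) (fun n => Eventually.of_forall fun ω => φ.norm_coe_le_norm _) ?_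
      · exact (φ.continuous.measurable.comp ((hWm u).sub (hWm (r n)))).aestronglyMeasurable
      · filter_upwards [hQP.ae_le hW.cont] with ω hω
        exact (φ.continuous.tendsto _).comp
          (tendsto_const_nhds.sub ((hω.tendsto s).comp hrlim))
    refine tendsto_nhds_unique
      (hlim (P.restrict A) inferInstance Measure.restrict_le_self.absolutelyContinuous) ?_
    simp_rw [hstep]
    exact (hlim P inferInstance Measure.AbsolutelyContinuous.rfl).const_mul _
  law s u hsu := by
    have h := hW.hasLaw_sub u s
    have h2 : nndist (u : ℝ) (s : ℝ) = u - s := by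
      rw [← NNReal.coe_inj, coe_nndist, Real.dist_eq, NNReal.coe_sub hsu, abs_of_nonneg]
      exact sub_nonneg.2 (NNReal.coe_le_coe.2 hsu)
    exact h2 ▸ h
  cont := hW.cont

end

/-! ### The isometry for simple integrands -/

section

variable {Ω : Type*} {mΩ : MeasurableSpace Ω} {P : Measure Ω} {𝓕 : Filtration ℝ≥0 mΩ}
  {W : ℝ≥0 → Ω → ℝ}

theorem IsBrownianWrt.measurable (hB : IsBrownianWrt P 𝓕 W) (t : ℝ≥0) : Measurable (W t) :=
  (hB.adapted t).mono (𝓕.le t) le_rfl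

theorem IsBrownianWrt.indepFun (hB : IsBrownianWrt P 𝓕 W) {s u : ℝ≥0} (hsu : s ≤ u) {E : Type*}
    [MeasurableSpace E] {G : Ω → E} (hG : Measurable[𝓕 s] G) :
    IndepFun G (fun ω => W u ω - W s ω) P :=
  indep_of_indep_of_le_left (hB.indep s u hsu) hG.comap_le

theorem IsBrownianWrt.memLp_increment (hB : IsBrownianWrt P 𝓕 W) {s u : ℝ≥0} (hsu : s ≤ u) :
    MemLp (fun ω => W u ω - W s ω) 2 P :=
  (hB.law s u hsu).hasGaussianLaw.memLp_two

theorem IsBrownianWrt.integral_increment (hB : IsBrownianWrt P 𝓕 W) {s u : ℝ≥0} (hsu : s ≤ u) :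
    ∫ ω, (W u ω - W s ω) ∂P = 0 := by
  rw [(hB.law s u hsu).integral_eq, integral_id_gaussianReal]

theorem IsBrownianWrt.integral_increment_sq (hB : IsBrownianWrt P 𝓕 W) {s u : ℝ≥0}
    (hsu : s ≤ u) : ∫ ω, (W u ω - W s ω) ^ 2 ∂P = (u - s : ℝ≥0) := by
  have h1 := (hB.law s u hsu).variance_eq
  rw [variance_id_gaussianReal,
    variance_of_integral_eq_zero (hB.law s u hsu).aemeasurable (hB.integral_increment hsu)] at h1
  exact h1

theorem IsBrownianWrt.integral_mul_increment (hB : IsBrownianWrt P 𝓕 W) {s u : ℝ≥0}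
    (hsu : s ≤ u) {G : Ω → ℝ} (hG : Measurable[𝓕 s] G) :
    ∫ ω, G ω * (W u ω - W s ω) ∂P = 0 := by
  rw [(hB.indepFun hsu hG).integral_fun_mul_eq_mul_integral
    (hG.mono (𝓕.le s) le_rfl).aestronglyMeasurable
    ((hB.measurable u).sub (hB.measurable s)).aestronglyMeasurable,
    hB.integral_increment hsu, mul_zero]

theorem IsBrownianWrt.integral_mul_increment_sq (hB : IsBrownianWrt P 𝓕 W) {s u : ℝ≥0}
    (hsu : s ≤ u) {G : Ω → ℝ} (hG : Measurable[𝓕 s] G) :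
    ∫ ω, G ω * (W u ω - W s ω) ^ 2 ∂P = (∫ ω, G ω ∂P) * (u - s : ℝ≥0) := by
  have h1 : IndepFun G (fun ω => (W u ω - W s ω) ^ 2) P :=
    (hB.indepFun hsu hG).comp measurable_id (measurable_id.pow_const 2)
  rw [h1.integral_fun_mul_eq_mul_integral
    (hG.mono (𝓕.le s) le_rfl).aestronglyMeasurable
    (((hB.measurable u).sub (hB.measurable s)).pow_const 2).aestronglyMeasurable,
    hB.integral_increment_sq hsu]

theorem IsBrownianWrt.integrable_mul_increment (hB : IsBrownianWrt P 𝓕 W) {a b a' b' : ℝ≥0}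
    (h : a ≤ b) (h' : a' ≤ b') {G : Ω → ℝ} (hG : Measurable G) {c : ℝ} (hc : ∀ ω, |G ω| ≤ c) :
    Integrable (fun ω => G ω * ((W b ω - W a ω) * (W b' ω - W a' ω))) P :=
  ((hB.memLp_increment h).integrable_mul (hB.memLp_increment h')).bdd_mul
    hG.aestronglyMeasurable (Eventually.of_forall hc)

theorem IsBrownianWrt.integral_mul_increment_mul_of_le (hB : IsBrownianWrt P 𝓕 W)
    {a b b' : ℝ≥0} (h : a ≤ b) (h' : b ≤ b') {G : Ω → ℝ} (hG : Measurable[𝓕 a] G) {c : ℝ}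
    (hc : ∀ ω, |G ω| ≤ c) :
    ∫ ω, G ω * ((W b ω - W a ω) * (W b' ω - W a ω)) ∂P = (∫ ω, G ω ∂P) * (b - a : ℝ≥0) := by
  have hGm : Measurable G := hG.mono (𝓕.le a) le_rfl
  have h1 : ∀ ω, G ω * ((W b ω - W a ω) * (W b' ω - W a ω))
      = G ω * ((W b ω - W a ω) * (W b ω - W a ω))
        + G ω * ((W b ω - W a ω) * (W b' ω - W b ω)) := fun ω => by ring
  simp_rw [h1]
  rw [integral_add (hB.integrable_mul_increment h h hGm hc)
    (hB.integrable_mul_increment h h' hGm hc)]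
  simp_rw [← sq, ← mul_assoc]
  rw [hB.integral_mul_increment_sq h hG, hB.integral_mul_increment h', add_zero]
  exact (hG.mono (𝓕.mono h) le_rfl).mul
    ((hB.adapted b).sub ((hB.adapted a).mono (𝓕.mono h) le_rfl))

theorem IsBrownianWrt.integral_mul_increment_mul (hB : IsBrownianWrt P 𝓕 W)
    {a b b' : ℝ≥0} (h : a ≤ b) (h' : a ≤ b') {G : Ω → ℝ} (hG : Measurable[𝓕 a] G) {c : ℝ}
    (hc : ∀ ω, |G ω| ≤ c) :
    ∫ ω, G ω * ((W b ω - W a ω) * (W b' ω - W a ω)) ∂P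
      = (∫ ω, G ω ∂P) * (min b b' - a : ℝ≥0) := by
  rcases le_total b b' with hb | hb
  · rw [min_eq_left hb, hB.integral_mul_increment_mul_of_le h hb hG hc]
  · rw [min_eq_right hb, ← hB.integral_mul_increment_mul_of_le h' hb hG hc]
    simp_rw [mul_comm (W b _ - W a _)]

theorem abs_mul_le_mul {x y c d : ℝ} (hx : |x| ≤ c) (hy : |y| ≤ d) : |x * y| ≤ c * d := by
  rw [abs_mul]
  exact mul_le_mul hx hy (abs_nonneg _) ((abs_nonneg _).trans hx)

/-- The covariance of two weighted increments, over intervals in arbitrary position. The difference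
`min b b' - max a a'` is truncated at zero, as it should be for disjoint intervals. -/
theorem IsBrownianWrt.integral_weighted_increments (hB : IsBrownianWrt P 𝓕 W)
    {a b a' b' : ℝ≥0} (h : a ≤ b) (h' : a' ≤ b') {ξ ξ' : Ω → ℝ} (hξ : Measurable[𝓕 a] ξ)
    (hξ' : Measurable[𝓕 a'] ξ') {c c' : ℝ} (hc : ∀ ω, |ξ ω| ≤ c) (hc' : ∀ ω, |ξ' ω| ≤ c') :
    ∫ ω, (ξ ω * (W b ω - W a ω)) * (ξ' ω * (W b' ω - W a' ω)) ∂P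
      = (∫ ω, ξ ω * ξ' ω ∂P) * (min b b' - max a a' : ℝ≥0) := by
  wlog haa : a ≤ a' generalizing a b a' b' ξ ξ' c c'
  · have := this h' h hξ' hξ hc' hc (not_le.1 haa).le
    have h1 : ∫ ω, ξ ω * ξ' ω ∂P = ∫ ω, ξ' ω * ξ ω ∂P := by
      congr 1; funext ω; ring
    rw [h1, min_comm, max_comm, ← this]
    congr 1; funext ω; ring
  rw [max_eq_right haa]
  have hξa' : Measurable[𝓕 a'] ξ := hξ.mono (𝓕.mono haa) le_rfl
  rcases le_total b a' with hba | hba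
  · rw [tsub_eq_zero_of_le ((min_le_left _ _).trans hba), NNReal.coe_zero, mul_zero]
    simp_rw [← mul_assoc]
    refine hB.integral_mul_increment h' ?_
    exact (hξa'.mul (((hB.adapted b).mono (𝓕.mono hba) le_rfl).sub
      ((hB.adapted a).mono (𝓕.mono haa) le_rfl))).mul hξ'
  · have hprod : Measurable[𝓕 a'] (fun ω => ξ ω * ξ' ω) := hξa'.mul hξ'
    have hbd : ∀ ω, |ξ ω * ξ' ω| ≤ c * c' := fun ω => abs_mul_le_mul (hc ω) (hc' ω)
    have hm : Measurable (fun ω => ξ ω * ξ' ω) := hprod.mono (𝓕.le a') le_rfl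
    have h1 : ∀ ω, (ξ ω * (W b ω - W a ω)) * (ξ' ω * (W b' ω - W a' ω))
        = (ξ ω * ξ' ω) * ((W a' ω - W a ω) * (W b' ω - W a' ω))
          + (ξ ω * ξ' ω) * ((W b ω - W a' ω) * (W b' ω - W a' ω)) := fun ω => by ring
    simp_rw [h1]
    rw [integral_add (hB.integrable_mul_increment haa h' hm hbd)
      (hB.integrable_mul_increment hba h' hm hbd),
      hB.integral_mul_increment_mul hba h' hprod hbd]
    simp_rw [← mul_assoc]
    rw [hB.integral_mul_increment h', zero_add]
    exact hprod.mul ((hB.adapted a').sub ((hB.adapted a).mono (𝓕.mono haa) le_rfl))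

/-- The increment over `[s, u]` of the path `t ↦ x (min b t) - x (min a t)` is the increment of `x`
over `(a, b] ∩ [s, u]`. The right end point is clamped from below by the left one, so that the end
points remain ordered when this intersection is empty. -/
theorem increment_min_eq_clamp (x : ℝ≥0 → ℝ) {a b s u : ℝ≥0} (hab : a ≤ b) (hsu : s ≤ u) :
    (x (min b u) - x (min a u)) - (x (min b s) - x (min a s))
      = x (max (max a s) (min b u)) - x (max a s) := by
  rcases le_total b s with h1 | h1
  · rw [min_eq_left (h1.trans hsu), min_eq_left ((hab.trans h1).trans hsu), min_eq_left h1,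
      min_eq_left (hab.trans h1), max_eq_right (hab.trans h1), max_eq_left h1]
    ring
  rw [min_eq_right h1]
  rcases le_total a s with h2 | h2
  · rw [min_eq_left h2, min_eq_left (h2.trans hsu), max_eq_right h2,
      max_eq_right (le_min h1 hsu)]
    ring
  rw [min_eq_right h2, max_eq_left h2]
  rcases le_total a u with h3 | h3
  · rw [min_eq_left h3, max_eq_right (le_min hab h3)]
    ring
  · rw [min_eq_right h3, min_eq_right (h3.trans hab), max_eq_left h3]
    ring

theorem setIntegral_indicator_mul_indicator {a b a' b' s u : ℝ≥0} :
    ∫ r in Set.Ioc (s : ℝ) u, (Set.Ioc a b).indicator (fun _ => (1 : ℝ)) r.toNNReal *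
        (Set.Ioc a' b').indicator (fun _ => (1 : ℝ)) r.toNNReal
      = (min (max (max a s) (min b u)) (max (max a' s) (min b' u))
          - max (max a s) (max a' s) : ℝ≥0) := by
  have h1 : ∀ r : ℝ, (Set.Ioc a b).indicator (fun _ => (1 : ℝ)) r.toNNReal *
        (Set.Ioc a' b').indicator (fun _ => (1 : ℝ)) r.toNNReal
      = (Real.toNNReal ⁻¹' (Set.Ioc a b ∩ Set.Ioc a' b')).indicator 1 r := by
    intro r
    by_cases h : r.toNNReal ∈ Set.Ioc a b <;> by_cases h' : r.toNNReal ∈ Set.Ioc a' b' <;>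
      simp [Set.indicator, h, h']
  simp_rw [h1]
  have h2 : Set.Ioc (s : ℝ) u ∩ (Real.toNNReal ⁻¹' (Set.Ioc a b ∩ Set.Ioc a' b'))
      = Set.Ioc ((max (max a s) (max a' s) : ℝ≥0) : ℝ) ((min (min b u) (min b' u) : ℝ≥0) : ℝ) := by
    ext r
    simp only [Set.mem_inter_iff, Set.mem_Ioc, Set.mem_preimage, Real.lt_toNNReal_iff_coe_lt,
      Real.toNNReal_le_iff_le_coe, NNReal.coe_max, NNReal.coe_min, max_lt_iff, le_min_iff]
    tauto
  rw [setIntegral_indicator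
    (measurable_real_toNNReal (measurableSet_Ioc.inter measurableSet_Ioc)), h2]
  simp only [Pi.one_apply, integral_const, smul_eq_mul, mul_one, measureReal_restrict_apply_univ,
    Real.volume_real_Ioc]
  rw [← NNReal.coe_sub_def]
  congr 1
  rcases le_total (max (max a s) (max a' s)) (min (min b u) (min b' u)) with h | h
  · have h3 := (le_max_left _ _).trans (h.trans (min_le_left _ _))
    have h4 := (le_max_right _ _).trans (h.trans (min_le_right _ _))
    rw [max_eq_right h3, max_eq_right h4]
  · rw [tsub_eq_zero_of_le h, eq_comm, tsub_eq_zero_iff_le]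
    rcases le_total (max a s) (min b u) with h3 | h3
    · rcases le_total (max a' s) (min b' u) with h4 | h4
      · rwa [max_eq_right h3, max_eq_right h4]
      · rw [max_eq_left h4]
        exact (min_le_right _ _).trans (le_max_right _ _)
    · rw [max_eq_left h3]
      exact (min_le_left _ _).trans (le_max_left _ _)

theorem lintegral_enorm_sq_eq {α : Type*} [MeasurableSpace α] {μ : Measure α} {f : α → ℝ}
    (hf : Integrable (fun x => f x ^ 2) μ) :
    ∫⁻ x, ‖f x‖ₑ ^ 2 ∂μ = ENNReal.ofReal (∫ x, f x ^ 2 ∂μ) := by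
  rw [ofReal_integral_eq_lintegral_ofReal hf (Eventually.of_forall fun x => sq_nonneg _)]
  refine lintegral_congr fun x => ?_
  rw [Real.enorm_eq_ofReal_abs, ← ENNReal.ofReal_pow (abs_nonneg _), sq_abs]

theorem sq_sum_eq_sum_sum {κ : Type*} [Fintype κ] (x : κ → ℝ) :
    (∑ k, x k) ^ 2 = ∑ k, ∑ l, x k * x l := by
  rw [sq, Finset.sum_mul_sum]

/-- The isometry for a finite family of weighted intervals, over the time interval `[s, u]`. The
intervals may overlap in any way, so that no common refinement of partitions is needed to subtract
two simple integrands. -/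
theorem IsBrownianWrt.lintegral_sum_sq_eq [IsProbabilityMeasure P] (hB : IsBrownianWrt P 𝓕 W)
    {κ : Type*} [Fintype κ] {a b : κ → ℝ≥0} (hab : ∀ k, a k ≤ b k) {ξ : κ → Ω → ℝ}
    (hξ : ∀ k, Measurable[𝓕 (a k)] (ξ k)) (hbd : ∀ k, ∃ c : ℝ, ∀ ω, |ξ k ω| ≤ c) {s u : ℝ≥0}
    (hsu : s ≤ u) :
    ∫⁻ ω, ‖∑ k, ξ k ω * ((W (min (b k) u) ω - W (min (a k) u) ω)
        - (W (min (b k) s) ω - W (min (a k) s) ω))‖ₑ ^ 2 ∂P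
      = ∫⁻ r in Set.Ioc (s : ℝ) u, ∫⁻ ω,
        ‖∑ k, (Set.Ioc (a k) (b k)).indicator (fun _ => ξ k ω) r.toNNReal‖ₑ ^ 2 ∂P := by
  choose c hc using hbd
  set a' : κ → ℝ≥0 := fun k => max (a k) s with ha'
  set b' : κ → ℝ≥0 := fun k => max (max (a k) s) (min (b k) u) with hb'
  have hab' : ∀ k, a' k ≤ b' k := fun k => le_max_left _ _
  have hξ' : ∀ k, Measurable[𝓕 (a' k)] (ξ k) :=
    fun k => (hξ k).mono (𝓕.mono (le_max_left _ _)) le_rfl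
  have hξm : ∀ k, Measurable (ξ k) := fun k => (hξ k).mono (𝓕.le _) le_rfl
  set J : κ → ℝ → ℝ := fun k r => (Set.Ioc (a k) (b k)).indicator (fun _ => (1 : ℝ)) r.toNNReal
    with hJ
  have hJm : ∀ k, Measurable (J k) := fun k =>
    (measurable_const.indicator measurableSet_Ioc).comp measurable_real_toNNReal
  have hJ1 : ∀ k r, |J k r| ≤ 1 := by
    intro k r
    simp only [hJ, Set.indicator]
    split_ifs <;> simp
  have hpi : ∀ k l, Integrable (fun ω => ξ k ω * ξ l ω) P := fun k l =>
    (integrable_const (c k * c l)).mono' ((hξm k).mul (hξm l)).aestronglyMeasurable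
      (Eventually.of_forall fun ω => abs_mul_le_mul (hc k ω) (hc l ω))
  have hJi : ∀ k l, IntegrableOn (fun r => J k r * J l r) (Set.Ioc (s : ℝ) u) := fun k l =>
    (integrable_const (1 * 1 : ℝ)).mono' ((hJm k).mul (hJm l)).aestronglyMeasurable
      (Eventually.of_forall fun r => abs_mul_le_mul (hJ1 k r) (hJ1 l r))
  have hwi : ∀ k l, Integrable (fun ω => (ξ k ω * (W (b' k) ω - W (a' k) ω)) *
      (ξ l ω * (W (b' l) ω - W (a' l) ω))) P := by
    intro k l
    refine (hB.integrable_mul_increment (hab' k) (hab' l) ((hξm k).mul (hξm l))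
      (fun ω => abs_mul_le_mul (hc k ω) (hc l ω))).congr (Eventually.of_forall fun ω => ?_)
    simp only [Pi.mul_apply]
    ring
  have hleft : ∀ ω, ∑ k, ξ k ω * ((W (min (b k) u) ω - W (min (a k) u) ω)
        - (W (min (b k) s) ω - W (min (a k) s) ω))
      = ∑ k, ξ k ω * (W (b' k) ω - W (a' k) ω) := fun ω =>
    Finset.sum_congr rfl fun k _ => by
      rw [increment_min_eq_clamp (fun t => W t ω) (hab k) hsu]
  have hright : ∀ (r : ℝ) ω, ∑ k, (Set.Ioc (a k) (b k)).indicator (fun _ => ξ k ω) r.toNNReal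
      = ∑ k, ξ k ω * J k r := fun r ω =>
    Finset.sum_congr rfl fun k _ => by simp [hJ, Set.indicator]
  have hinner : ∀ r : ℝ, ∫⁻ ω, ‖∑ k, ξ k ω * J k r‖ₑ ^ 2 ∂P
      = ENNReal.ofReal (∑ k, ∑ l, (∫ ω, ξ k ω * ξ l ω ∂P) * (J k r * J l r)) := by
    intro r
    have h1 : ∀ ω, (∑ k, ξ k ω * J k r) ^ 2
        = ∑ k, ∑ l, (ξ k ω * ξ l ω) * (J k r * J l r) := by
      intro ω
      rw [sq_sum_eq_sum_sum]
      exact Finset.sum_congr rfl fun k _ => Finset.sum_congr rfl fun l _ => by ring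
    have h2 : ∀ k l, Integrable (fun ω => (ξ k ω * ξ l ω) * (J k r * J l r)) P :=
      fun k l => (hpi k l).mul_const _
    rw [lintegral_enorm_sq_eq]
    · simp_rw [h1]
      rw [integral_finsetSum _ fun k _ => integrable_finsetSum _ fun l _ => h2 k l]
      congr 1
      refine Finset.sum_congr rfl fun k _ => ?_
      rw [integral_finsetSum _ fun l _ => h2 k l]
      exact Finset.sum_congr rfl fun l _ => integral_mul_const _ _
    · simp_rw [h1]
      exact integrable_finsetSum _ fun k _ => integrable_finsetSum _ fun l _ => h2 k l
  simp_rw [hleft, hright, hinner]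
  have h3 : ∀ k l, IntegrableOn (fun r => (∫ ω, ξ k ω * ξ l ω ∂P) * (J k r * J l r))
      (Set.Ioc (s : ℝ) u) := fun k l => (hJi k l).const_mul _
  rw [lintegral_enorm_sq_eq, ← ofReal_integral_eq_lintegral_ofReal]
  · simp_rw [sq_sum_eq_sum_sum]
    rw [integral_finsetSum _ fun k _ => integrable_finsetSum _ fun l _ => hwi k l,
      integral_finsetSum _ fun k _ => integrable_finsetSum _ fun l _ => h3 k l]
    congr 1
    refine Finset.sum_congr rfl fun k _ => ?_
    rw [integral_finsetSum _ fun l _ => hwi k l, integral_finsetSum _ fun l _ => h3 k l]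
    refine Finset.sum_congr rfl fun l _ => ?_
    rw [hB.integral_weighted_increments (hab' k) (hab' l) (hξ' k) (hξ' l) (hc k) (hc l),
      integral_const_mul, setIntegral_indicator_mul_indicator]
  · exact integrable_finsetSum _ fun k _ => integrable_finsetSum _ fun l _ => h3 k l
  · refine Eventually.of_forall fun r => ?_
    have h4 : ∑ k, ∑ l, (∫ ω, ξ k ω * ξ l ω ∂P) * (J k r * J l r)
        = ∫ ω, (∑ k, ξ k ω * J k r) ^ 2 ∂P := by
      have h1 : ∀ ω, (∑ k, ξ k ω * J k r) ^ 2
          = ∑ k, ∑ l, (ξ k ω * ξ l ω) * (J k r * J l r) := by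
        intro ω
        rw [sq_sum_eq_sum_sum]
        exact Finset.sum_congr rfl fun k _ => Finset.sum_congr rfl fun l _ => by ring
      simp_rw [h1]
      rw [integral_finsetSum _ fun k _ => integrable_finsetSum _ fun l _ =>
        (hpi k l).mul_const _]
      refine Finset.sum_congr rfl fun k _ => ?_
      rw [integral_finsetSum _ fun l _ => (hpi k l).mul_const _]
      exact Finset.sum_congr rfl fun l _ => (integral_mul_const _ _).symm
    change 0 ≤ ∑ k, ∑ l, (∫ ω, ξ k ω * ξ l ω ∂P) * (J k r * J l r)
    rw [h4]
    exact integral_nonneg fun ω => sq_nonneg _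
  · simp_rw [sq_sum_eq_sum_sum]
    exact integrable_finsetSum _ fun k _ => integrable_finsetSum _ fun l _ => hwi k l

theorem SimpleIntegrand.lintegral_increment_sub_sq_eq [IsProbabilityMeasure P]
    (hB : IsBrownianWrt P 𝓕 W) (S S' : SimpleIntegrand 𝓕) {s u : ℝ≥0} (hsu : s ≤ u) :
    ∫⁻ ω, ‖(S.integral W u ω - S.integral W s ω) - (S'.integral W u ω - S'.integral W s ω)‖ₑ ^ 2 ∂P
      = ∫⁻ r in Set.Ioc (s : ℝ) u, ∫⁻ ω, ‖S.eval r.toNNReal ω - S'.eval r.toNNReal ω‖ₑ ^ 2 ∂P := by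
  have h := hB.lintegral_sum_sq_eq (κ := Fin S.n ⊕ Fin S'.n)
    (a := Sum.elim (fun i => S.time i) (fun i => S'.time i))
    (b := Sum.elim (fun i => S.time (i + 1)) (fun i => S'.time (i + 1)))
    (ξ := Sum.elim (fun i => S.ξ i) (fun i ω => -S'.ξ i ω)) ?_ ?_ ?_ hsu
  · simp only [Fintype.sum_sum_type, Sum.elim_inl, Sum.elim_inr] at h
    have h1 : ∀ ω, (S.integral W u ω - S.integral W s ω)
        - (S'.integral W u ω - S'.integral W s ω)
        = ∑ i : Fin S.n, S.ξ i ω * ((W (min (S.time (i + 1)) u) ω - W (min (S.time i) u) ω)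
            - (W (min (S.time (i + 1)) s) ω - W (min (S.time i) s) ω))
          + ∑ i : Fin S'.n, -S'.ξ i ω * ((W (min (S'.time (i + 1)) u) ω - W (min (S'.time i) u) ω)
            - (W (min (S'.time (i + 1)) s) ω - W (min (S'.time i) s) ω)) := by
      intro ω
      simp only [SimpleIntegrand.integral, Finset.sum_range, ← Finset.sum_sub_distrib]
      rw [sub_eq_add_neg (∑ i : Fin S.n, _) (∑ i : Fin S'.n, _), ← Finset.sum_neg_distrib]
      congr 1 <;> refine Finset.sum_congr rfl fun i _ => ?_ <;> ring
    have h2 : ∀ (r : ℝ) ω, S.eval r.toNNReal ω - S'.eval r.toNNReal ω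
        = ∑ i : Fin S.n, (Set.Ioc (S.time i) (S.time (i + 1))).indicator
            (fun _ => S.ξ i ω) r.toNNReal
          + ∑ i : Fin S'.n, (Set.Ioc (S'.time i) (S'.time (i + 1))).indicator
            (fun _ => -S'.ξ i ω) r.toNNReal := by
      intro r ω
      simp only [SimpleIntegrand.eval, Finset.sum_range]
      rw [sub_eq_add_neg (∑ i : Fin S.n, _) (∑ i : Fin S'.n, _), ← Finset.sum_neg_distrib]
      congr 1
      refine Finset.sum_congr rfl fun i _ => ?_
      simp only [Set.indicator]
      split_ifs <;> simp
    simp_rw [h1, h2]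
    exact h
  · rintro (i | i)
    · exact S.time_mono (Nat.le_succ _)
    · exact S'.time_mono (Nat.le_succ _)
  · rintro (i | i)
    · exact S.ξ_meas i
    · exact (S'.ξ_meas i).neg
  · rintro (i | i)
    · exact S.ξ_bdd i
    · obtain ⟨c, hc⟩ := S'.ξ_bdd i
      exact ⟨c, fun ω => by simpa using hc ω⟩

end

/-! ### Mean square distance between an Itô integral and simple integrals -/

theorem enorm_add_sq_le (x y : ℝ) : ‖x + y‖ₑ ^ 2 ≤ 2 * ‖x‖ₑ ^ 2 + 2 * ‖y‖ₑ ^ 2 := by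
  have h : ∀ z : ℝ, ‖z‖ₑ ^ 2 = ENNReal.ofReal (z ^ 2) := fun z => by
    rw [Real.enorm_eq_ofReal_abs, ← ENNReal.ofReal_pow (abs_nonneg _), sq_abs]
  have h2 : (2 : ℝ≥0∞) = ENNReal.ofReal 2 := by simp
  rw [h, h, h, h2, ← ENNReal.ofReal_mul (by norm_num), ← ENNReal.ofReal_mul (by norm_num),
    ← ENNReal.ofReal_add (by positivity) (by positivity)]
  refine ENNReal.ofReal_le_ofReal ?_
  nlinarith [sq_nonneg (x - y)]

theorem lintegral_enorm_sub_sq_le {α : Type*} [MeasurableSpace α] {μ : Measure α} {f g h : α → ℝ}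
    (hf : AEMeasurable f μ) (hg : AEMeasurable g μ) :
    ∫⁻ x, ‖f x - h x‖ₑ ^ 2 ∂μ
      ≤ 2 * ∫⁻ x, ‖f x - g x‖ₑ ^ 2 ∂μ + 2 * ∫⁻ x, ‖g x - h x‖ₑ ^ 2 ∂μ := by
  have hm : AEMeasurable (fun x => ‖f x - g x‖ₑ ^ 2) μ := (hf.sub hg).enorm.pow_const 2
  rw [← lintegral_const_mul'' _ hm, ← lintegral_const_mul' _ _ (by simp),
    ← lintegral_add_left' (hm.const_mul 2)]
  refine lintegral_mono fun x => ?_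
  rw [show f x - h x = (f x - g x) + (g x - h x) by ring]
  exact enorm_add_sq_le _ _

section

variable {Ω : Type*} {mΩ : MeasurableSpace Ω} {P : Measure Ω} {𝓕 : Filtration ℝ≥0 mΩ}
  {W : ℝ≥0 → Ω → ℝ}

theorem SimpleIntegrand.measurable_eval (S : SimpleIntegrand 𝓕) :
    Measurable fun p : ℝ × Ω => S.eval p.1.toNNReal p.2 := by
  refine Finset.measurable_sum _ fun i _ => ?_
  have h1 : (fun p : ℝ × Ω => (Set.Ioc (S.time i) (S.time (i + 1))).indicator
      (fun _ => S.ξ i p.2) p.1.toNNReal)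
      = {p : ℝ × Ω | p.1.toNNReal ∈ Set.Ioc (S.time i) (S.time (i + 1))}.indicator
        (fun p => S.ξ i p.2) := by
    funext p
    simp [Set.indicator]
  rw [h1]
  exact (((S.ξ_meas i).mono (𝓕.le _) le_rfl).comp measurable_snd).indicator
    ((measurable_real_toNNReal.comp measurable_fst) measurableSet_Ioc)

theorem SimpleIntegrand.measurable_integral (S : SimpleIntegrand 𝓕)
    (hWm : ∀ t, Measurable (W t)) (t : ℝ≥0) : Measurable (S.integral W t) := by
  refine Finset.measurable_sum _ fun i _ => ?_
  exact ((S.ξ_meas i).mono (𝓕.le _) le_rfl).mul ((hWm _).sub (hWm _))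

/-- The mean square distance, at time `r`, between a simple integrand and the process `Z`. -/
noncomputable def sqDist (P : Measure Ω) (S : SimpleIntegrand 𝓕) (Z : ℝ≥0 → Ω → ℝ) (r : ℝ) : ℝ≥0∞ :=
  ∫⁻ ω, ‖S.eval r.toNNReal ω - Z r.toNNReal ω‖ₑ ^ 2 ∂P

variable [IsProbabilityMeasure P] {Z I : ℝ≥0 → Ω → ℝ} {T : ℝ≥0}

theorem measurable_sqDist (hZ : Measurable fun p : ℝ × Ω => Z p.1.toNNReal p.2)
    (S : SimpleIntegrand 𝓕) : Measurable (sqDist P S Z) :=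
  ((S.measurable_eval.sub hZ).enorm.pow_const 2).lintegral_prod_right'

theorem lintegral_sqDist (hZ : Measurable fun p : ℝ × Ω => Z p.1.toNNReal p.2)
    (S : SimpleIntegrand 𝓕) (A : Set ℝ) :
    ∫⁻ r in A, sqDist P S Z r
      = ∫⁻ ω, ∫⁻ r in A, ‖S.eval r.toNNReal ω - Z r.toNNReal ω‖ₑ ^ 2 ∂volume ∂P :=
  lintegral_lintegral_swap ((S.measurable_eval.sub hZ).enorm.pow_const 2).aemeasurable

/-- Half of the Itô isometry, up to a constant: it is inherited by `L²`-limits of simple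
integrands. -/
theorem lintegral_increment_sub_le (hB : IsBrownianWrt P 𝓕 W)
    (hZ : Measurable fun p : ℝ × Ω => Z p.1.toNNReal p.2) {S : ℕ → SimpleIntegrand 𝓕}
    (hS : Tendsto (fun n => ∫⁻ r in Set.Icc (0 : ℝ) T, sqDist P (S n) Z r) atTop (𝓝 0))
    (hIm : ∀ t ≤ T, Measurable (I t))
    (hI : ∀ t ≤ T, Tendsto (fun n => ∫⁻ ω, ‖(S n).integral W t ω - I t ω‖ₑ ^ 2 ∂P) atTop (𝓝 0))
    {s u : ℝ≥0} (hsu : s ≤ u) (huT : u ≤ T) (n : ℕ) :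
    ∫⁻ ω, ‖(I u ω - I s ω) - ((S n).integral W u ω - (S n).integral W s ω)‖ₑ ^ 2 ∂P
      ≤ 4 * ∫⁻ r in Set.Ioc (s : ℝ) u, sqDist P (S n) Z r := by
  have hsT := hsu.trans huT
  have hSm : ∀ m t, Measurable ((S m).integral W t) := fun m t =>
    (S m).measurable_integral hB.measurable t
  have hsub : Set.Ioc (s : ℝ) u ⊆ Set.Icc 0 T := fun r hr =>
    ⟨s.coe_nonneg.trans hr.1.le, hr.2.trans (NNReal.coe_le_coe.2 huT)⟩
  set D := ∫⁻ r in Set.Ioc (s : ℝ) u, sqDist P (S n) Z r with hD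
  set e : ℕ → ℝ≥0∞ := fun m =>
    2 * (2 * ∫⁻ ω, ‖(S m).integral W u ω - I u ω‖ₑ ^ 2 ∂P
      + 2 * ∫⁻ ω, ‖(S m).integral W s ω - I s ω‖ₑ ^ 2 ∂P)
    + 2 * (2 * (∫⁻ r in Set.Icc (0 : ℝ) T, sqDist P (S m) Z r) + 2 * D) with he
  have hlim : Tendsto e atTop (𝓝 (2 * (2 * 0 + 2 * 0) + 2 * (2 * 0 + 2 * D))) := by
    have h2 : (2 : ℝ≥0∞) ≠ ⊤ := by simp
    have h3 : Tendsto (fun _ : ℕ => 2 * D) atTop (𝓝 (2 * D)) := tendsto_const_nhds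
    exact (ENNReal.Tendsto.const_mul ((ENNReal.Tendsto.const_mul (hI u huT) (Or.inr h2)).add
      (ENNReal.Tendsto.const_mul (hI s hsT) (Or.inr h2))) (Or.inr h2)).add
      (ENNReal.Tendsto.const_mul ((ENNReal.Tendsto.const_mul hS (Or.inr h2)).add
        h3) (Or.inr h2))
  have h4 : 2 * (2 * 0 + 2 * 0) + 2 * (2 * 0 + 2 * D) = 4 * D := by
    rw [mul_zero, zero_add, mul_zero, zero_add, zero_add, ← mul_assoc]; norm_num
  rw [h4] at hlim
  refine ge_of_tendsto' hlim fun m => ?_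
  refine (lintegral_enorm_sub_sq_le (g := fun ω => (S m).integral W u ω - (S m).integral W s ω)
    ((hIm u huT).sub (hIm s hsT)).aemeasurable
    ((hSm m u).sub (hSm m s)).aemeasurable).trans ?_
  refine add_le_add (mul_le_mul_right ?_ 2) (mul_le_mul_right ?_ 2)
  · have hmeas : Measurable fun ω => 2 * ‖(S m).integral W u ω - I u ω‖ₑ ^ 2 :=
      (((hSm m u).sub (hIm u huT)).enorm.pow_const 2).const_mul 2
    rw [← lintegral_const_mul' _ _ (by simp), ← lintegral_const_mul' _ _ (by simp),
      ← lintegral_add_left hmeas]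
    refine lintegral_mono fun ω => ?_
    rw [← enorm_neg]
    have := enorm_add_sq_le ((S m).integral W u ω - I u ω) (-((S m).integral W s ω - I s ω))
    rw [enorm_neg] at this
    refine le_trans (le_of_eq ?_) this
    simp only [Pi.sub_apply]
    congr 2
    ring
  · rw [SimpleIntegrand.lintegral_increment_sub_sq_eq hB (S m) (S n) hsu]
    have h5 : ∀ r : ℝ, ∫⁻ ω, ‖(S m).eval r.toNNReal ω - (S n).eval r.toNNReal ω‖ₑ ^ 2 ∂P
        ≤ 2 * sqDist P (S m) Z r + 2 * sqDist P (S n) Z r := by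
      intro r
      refine (lintegral_enorm_sub_sq_le (g := Z r.toNNReal)
        ((S m).measurable_eval.comp measurable_prodMk_left).aemeasurable
        (hZ.comp measurable_prodMk_left).aemeasurable).trans ?_
      refine add_le_add le_rfl (mul_le_mul_right (le_of_eq ?_) 2)
      exact lintegral_congr fun ω => by rw [← enorm_neg, neg_sub]
    refine (lintegral_mono h5).trans ?_
    rw [lintegral_add_left ((measurable_sqDist hZ (S m)).const_mul 2),
      lintegral_const_mul' _ _ (by simp), lintegral_const_mul' _ _ (by simp)]
    exact add_le_add (mul_le_mul_right (lintegral_mono_set hsub) 2) le_rfl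

end

/-! ### Identification of a coefficient from a small Gaussian increment -/

/-- The truncation `min 1 |x|`, as an extended nonnegative number. -/
noncomputable def trunc (x : ℝ) : ℝ≥0∞ := ENNReal.ofReal (min 1 |x|)

theorem trunc_le_one (x : ℝ) : trunc x ≤ 1 := by
  rw [trunc, ENNReal.ofReal_le_one]; exact min_le_left _ _

theorem trunc_neg (x : ℝ) : trunc (-x) = trunc x := by rw [trunc, trunc, abs_neg]

theorem continuous_trunc : Continuous trunc :=
  ENNReal.continuous_ofReal.comp (continuous_const.min continuous_abs)

theorem trunc_eq_zero {x : ℝ} : trunc x = 0 ↔ x = 0 := by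
  rw [trunc, ENNReal.ofReal_eq_zero]
  constructor
  · intro h
    rcases min_le_iff.1 h with h | h
    · norm_num at h
    · exact abs_nonpos_iff.1 h
  · rintro rfl
    simp

theorem trunc_add_le (x y : ℝ) : trunc (x + y) ≤ trunc x + trunc y := by
  rw [trunc, trunc, trunc, ← ENNReal.ofReal_add (by positivity) (by positivity)]
  refine ENNReal.ofReal_le_ofReal ?_
  have h0 := abs_add_le x y
  have := abs_nonneg x
  have := abs_nonneg y
  rcases le_total 1 |x| with h1 | h1 <;> rcases le_total 1 |y| with h2 | h2 <;>
    simp only [h1, h2, min_eq_left, min_eq_right]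
  · exact (min_le_left _ _).trans (by norm_num)
  · exact (min_le_left _ _).trans (by linarith)
  · exact (min_le_left _ _).trans (by linarith)
  · exact (min_le_right _ _).trans h0

theorem trunc_mul_trunc_le (x y : ℝ) : trunc x * trunc y ≤ trunc (x * y) := by
  rw [trunc, trunc, trunc, ← ENNReal.ofReal_mul (by positivity)]
  refine ENNReal.ofReal_le_ofReal (le_min ?_ ?_)
  · exact mul_le_one₀ (min_le_left _ _) (by positivity) (min_le_left _ _)
  · rw [abs_mul]
    exact mul_le_mul (min_le_right _ _) (min_le_right _ _) (by positivity) (abs_nonneg _)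

theorem trunc_le_add_sq (x : ℝ) {ε : ℝ} (hε : 0 < ε) :
    trunc x ≤ ENNReal.ofReal ε + ENNReal.ofReal ε⁻¹ * ‖x‖ₑ ^ 2 := by
  rw [Real.enorm_eq_ofReal_abs, ← ENNReal.ofReal_pow (abs_nonneg _),
    ← ENNReal.ofReal_mul (by positivity), ← ENNReal.ofReal_add hε.le (by positivity), trunc]
  refine ENNReal.ofReal_le_ofReal ((min_le_right _ _).trans ?_)
  rcases le_total |x| ε with h | h
  · have : 0 ≤ ε⁻¹ * |x| ^ 2 := by positivity
    linarith
  · have : |x| ≤ ε⁻¹ * |x| ^ 2 := by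
      rw [inv_mul_eq_div, le_div_iff₀ hε]
      nlinarith
    linarith

theorem trunc_mul_le (x y : ℝ) {ε : ℝ} (hε : 0 < ε) (hε1 : ε ≤ 1) :
    trunc (x * y) ≤ ENNReal.ofReal ε⁻¹ * trunc x + ENNReal.ofReal ε * ‖y‖ₑ ^ 2 := by
  rw [Real.enorm_eq_ofReal_abs, ← ENNReal.ofReal_pow (abs_nonneg _), trunc, trunc,
    ← ENNReal.ofReal_mul (by positivity), ← ENNReal.ofReal_mul (by positivity),
    ← ENNReal.ofReal_add (by positivity) (by positivity)]
  refine ENNReal.ofReal_le_ofReal ?_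
  have hinv : 1 ≤ ε⁻¹ := (one_le_inv₀ hε).2 hε1
  rcases le_total |y| ε⁻¹ with h | h
  · have h1 : min 1 |x * y| ≤ ε⁻¹ * min 1 |x| := by
      rcases le_total 1 |x| with h2 | h2
      · rw [min_eq_left h2, mul_one]
        exact (min_le_left _ _).trans hinv
      · rw [min_eq_right h2, abs_mul, mul_comm |x|]
        exact (min_le_right _ _).trans (by gcongr)
    have : 0 ≤ ε * |y| ^ 2 := by positivity
    linarith
  · have h1 : 1 ≤ ε * |y| := by
      rwa [inv_le_iff_one_le_mul₀' hε] at h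
    have h2 : 1 ≤ |y| := hinv.trans h
    have h3 : 1 ≤ ε * |y| ^ 2 := by nlinarith
    have h4 : 0 ≤ ε⁻¹ * min 1 |x| := by positivity
    linarith [min_le_left 1 |x * y|]

theorem tendsto_lintegral_trunc {Ω : Type*} {mΩ : MeasurableSpace Ω} {P : Measure Ω}
    [IsProbabilityMeasure P] {a : ℕ → Ω → ℝ} (ham : ∀ k, Measurable (a k))
    (ha : ∀ᵐ ω ∂P, Tendsto (fun k => a k ω) atTop (𝓝 0)) :
    Tendsto (fun k => ∫⁻ ω, trunc (a k ω) ∂P) atTop (𝓝 0) := by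
  have h := tendsto_lintegral_of_dominated_convergence (μ := P) (F := fun k ω => trunc (a k ω))
    (f := fun _ => 0) (fun _ => 1) (fun k => continuous_trunc.measurable.comp (ham k))
    (fun k => Eventually.of_forall fun ω => trunc_le_one _) (by simp) ?_
  · simpa using h
  · filter_upwards [ha] with ω hω
    have := (continuous_trunc.tendsto 0).comp hω
    rwa [trunc_eq_zero.2 rfl] at this

/-- Let the `N k` be standard Gaussian and independent of the σ-algebra `m`, and let `θ` be
`m`-measurable. If `D k` is `θ * N k` up to an error that tends to zero in probability, and if
`D k` is close to `σ * N k` in mean square for `m`-measurable approximations `σ` of `ζ`, then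
`ζ = θ`: a nonzero difference `σ - θ` would be seen after multiplication by an independent Gaussian
variable. -/
theorem ae_eq_of_gaussian_increment {Ω : Type*} {m mΩ : MeasurableSpace Ω} {P : Measure Ω}
    [IsProbabilityMeasure P] (hm : m ≤ mΩ) {θ ζ : Ω → ℝ} (hθ : Measurable[m] θ)
    (hζ : Measurable ζ) {N D a r : ℕ → Ω → ℝ}
    (hNm : ∀ k, Measurable (N k)) (hDm : ∀ k, Measurable (D k)) (ham : ∀ k, Measurable (a k))
    (hrm : ∀ k, Measurable (r k))
    (hind : ∀ k, Indep m (MeasurableSpace.comap (N k) inferInstance) P)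
    (hlaw : ∀ k, HasLaw (N k) (gaussianReal 0 1) P)
    (ha : ∀ᵐ ω ∂P, Tendsto (fun k => a k ω) atTop (𝓝 0))
    (hr : ∀ᵐ ω ∂P, Tendsto (fun k => r k ω) atTop (𝓝 0))
    (hD : ∀ᶠ k in atTop, ∀ᵐ ω ∂P, D k ω = θ ω * N k ω + a k ω + r k ω * N k ω)
    (happ : ∀ ε : ℝ, 0 < ε → ∃ σ : Ω → ℝ, Measurable[m] σ ∧
      ∫⁻ ω, ‖σ ω - ζ ω‖ₑ ^ 2 ∂P ≤ ENNReal.ofReal (ε ^ 2) ∧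
      ∀ᶠ k in atTop, ∫⁻ ω, ‖D k ω - σ ω * N k ω‖ₑ ^ 2 ∂P ≤ ENNReal.ofReal (9 * ε ^ 2)) :
    ∀ᵐ ω ∂P, ζ ω = θ ω := by
  have htm := continuous_trunc.measurable
  have hθm : Measurable θ := hθ.mono hm le_rfl
  have hmt : ∀ f : Ω → ℝ, Measurable f → Measurable fun ω => trunc (f ω) :=
    fun f hf => htm.comp hf
  set c := ∫⁻ x, trunc x ∂(gaussianReal 0 1) with hc
  have hc1 : c ≤ 1 := by
    refine (lintegral_mono trunc_le_one).trans ?_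
    simp
  have hc0 : c ≠ 0 := by
    intro h
    have h1 := (lintegral_eq_zero_iff htm).1 h
    have h2 : ∀ᵐ x ∂(gaussianReal 0 1), x = 0 := h1.mono fun x hx => trunc_eq_zero.1 hx
    have := nullSingletonClass_gaussianReal (μ := 0) (one_ne_zero (α := ℝ≥0))
    have h3 : ∀ᵐ x ∂(gaussianReal 0 1), x ≠ 0 := by
      rw [ae_iff]
      simp
    have h4 : ∀ᵐ _x ∂(gaussianReal 0 1), False := (h2.and h3).mono fun x hx => hx.2 hx.1
    simp only [eventually_false_iff_eq_bot, ae_eq_bot] at h4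
    exact IsProbabilityMeasure.ne_zero _ h4
  have hNc : ∀ k, ∫⁻ ω, trunc (N k ω) ∂P = c := fun k => by
    rw [hc, ← (hlaw k).map_eq, lintegral_map htm (hNm k)]
  have hN2 : ∀ k, ∫⁻ ω, ‖N k ω‖ₑ ^ 2 ∂P = 1 := fun k => by
    have h1 : MemLp (N k) 2 P := (hlaw k).hasGaussianLaw.memLp_two
    have h2 := (hlaw k).variance_eq
    rw [variance_id_gaussianReal, variance_of_integral_eq_zero (hNm k).aemeasurable
      (by rw [(hlaw k).integral_eq, integral_id_gaussianReal])] at h2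
    rw [lintegral_enorm_sq_eq h1.integrable_sq, h2]
    simp
  -- `c` is the mean of `trunc (N k)`. By independence it factors out of the mean of
  -- `trunc (σ - θ) * trunc (N k)`, which is at most that of `trunc ((σ - θ) * N k)`.
  have hmain : ∀ ε : ℝ, 0 < ε → ε ≤ 1 →
      c * ∫⁻ ω, trunc (ζ ω - θ ω) ∂P ≤ ENNReal.ofReal (13 * ε) := by
    intro ε hε hε1
    obtain ⟨σ, hσ, hσζ, hσD⟩ := happ ε hε
    have hσm : Measurable σ := hσ.mono hm le_rfl
    have hsmall : ∀ {f : Ω → ℝ} {d : ℝ}, Measurable f → 0 ≤ d →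
        ∫⁻ ω, ‖f ω‖ₑ ^ 2 ∂P ≤ ENNReal.ofReal (d * ε ^ 2) →
        ∫⁻ ω, trunc (f ω) ∂P ≤ ENNReal.ofReal ((1 + d) * ε) := by
      intro f d hf hd h
      refine (lintegral_mono fun ω => trunc_le_add_sq (f ω) hε).trans ?_
      rw [lintegral_add_left measurable_const, lintegral_const_mul' _ _ (by simp)]
      simp only [lintegral_const, measure_univ, mul_one]
      calc ENNReal.ofReal ε + ENNReal.ofReal ε⁻¹ * ∫⁻ ω, ‖f ω‖ₑ ^ 2 ∂P
          ≤ ENNReal.ofReal ε + ENNReal.ofReal ε⁻¹ * ENNReal.ofReal (d * ε ^ 2) := by gcongr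
        _ = ENNReal.ofReal ((1 + d) * ε) := by
            rw [← ENNReal.ofReal_mul (by positivity), ← ENNReal.ofReal_add hε.le (by positivity)]
            congr 1
            field_simp
    have h1 : c * ∫⁻ ω, trunc (σ ω - θ ω) ∂P ≤ ENNReal.ofReal (11 * ε) := by
      have hlim : Tendsto (fun k => ENNReal.ofReal (10 * ε) + (∫⁻ ω, trunc (a k ω) ∂P
          + (ENNReal.ofReal ε⁻¹ * ∫⁻ ω, trunc (r k ω) ∂P + ENNReal.ofReal ε))) atTop
          (𝓝 (ENNReal.ofReal (10 * ε) + (0 + (ENNReal.ofReal ε⁻¹ * 0 + ENNReal.ofReal ε)))) :=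
        tendsto_const_nhds.add ((tendsto_lintegral_trunc ham ha).add
          ((ENNReal.Tendsto.const_mul (tendsto_lintegral_trunc hrm hr)
            (Or.inr ENNReal.ofReal_ne_top)).add tendsto_const_nhds))
      rw [mul_zero, zero_add, zero_add, ← ENNReal.ofReal_add (by positivity) hε.le,
        show 10 * ε + ε = 11 * ε by ring] at hlim
      refine ge_of_tendsto hlim ?_
      filter_upwards [hσD, hD] with k hk hDk
      have hindk : IndepFun (fun ω => trunc (σ ω - θ ω)) (fun ω => trunc (N k ω)) P := by
        have h2 : IndepFun (fun ω => σ ω - θ ω) (N k) P :=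
          indep_of_indep_of_le_left (hind k) (hσ.sub hθ).comap_le
        exact h2.comp htm htm
      have hprod := lintegral_mul_eq_lintegral_mul_lintegral_of_indepFun
        (htm.comp (hσm.sub hθm)) (htm.comp (hNm k)) hindk
      simp only [Pi.mul_apply] at hprod
      rw [← hNc k, mul_comm]
      refine hprod.symm.le.trans ?_
      have hpt : ∀ᵐ ω ∂P, trunc (σ ω - θ ω) * trunc (N k ω)
          ≤ trunc (D k ω - σ ω * N k ω) + (trunc (a k ω)
            + (ENNReal.ofReal ε⁻¹ * trunc (r k ω) + ENNReal.ofReal ε * ‖N k ω‖ₑ ^ 2)) := by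
        filter_upwards [hDk] with ω hω
        refine (trunc_mul_trunc_le _ _).trans ?_
        have h3 : (σ ω - θ ω) * N k ω = -(D k ω - σ ω * N k ω) + (a k ω + r k ω * N k ω) := by
          rw [hω]; ring
        rw [h3]
        refine (trunc_add_le _ _).trans ?_
        rw [trunc_neg]
        gcongr
        refine (trunc_add_le _ _).trans ?_
        gcongr
        exact trunc_mul_le _ _ hε hε1
      refine (lintegral_mono_ae hpt).trans ?_
      rw [lintegral_add_left (hmt (fun ω => D k ω - σ ω * N k ω) ((hDm k).sub (hσm.mul (hNm k)))),
        lintegral_add_left (hmt (a k) (ham k)),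
        lintegral_add_left ((hmt (r k) (hrm k)).const_mul _),
        lintegral_const_mul' _ _ (by simp), lintegral_const_mul' _ _ (by simp), hN2, mul_one]
      gcongr
      have := hsmall ((hDm k).sub (hσm.mul (hNm k))) (by norm_num) hk
      rwa [show (1 + 9 : ℝ) * ε = 10 * ε by ring] at this
    have h2 : ∫⁻ ω, trunc (σ ω - ζ ω) ∂P ≤ ENNReal.ofReal (2 * ε) := by
      have := hsmall (d := 1) (hσm.sub hζ) (by norm_num) (by rwa [one_mul])
      rwa [show (1 + 1 : ℝ) * ε = 2 * ε by ring] at this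
    calc c * ∫⁻ ω, trunc (ζ ω - θ ω) ∂P
        ≤ c * (∫⁻ ω, trunc (σ ω - ζ ω) ∂P + ∫⁻ ω, trunc (σ ω - θ ω) ∂P) := by
          rw [← lintegral_add_left (hmt (fun ω => σ ω - ζ ω) (hσm.sub hζ))]
          gcongr with ω
          rw [show ζ ω - θ ω = -(σ ω - ζ ω) + (σ ω - θ ω) by ring]
          refine (trunc_add_le _ _).trans ?_
          rw [trunc_neg]
      _ = c * ∫⁻ ω, trunc (σ ω - ζ ω) ∂P + c * ∫⁻ ω, trunc (σ ω - θ ω) ∂P := mul_add _ _ _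
      _ ≤ 1 * ENNReal.ofReal (2 * ε) + ENNReal.ofReal (11 * ε) := by gcongr
      _ = ENNReal.ofReal (13 * ε) := by
          rw [one_mul, ← ENNReal.ofReal_add (by positivity) (by positivity)]
          congr 1; ring
  have hzero : c * ∫⁻ ω, trunc (ζ ω - θ ω) ∂P = 0 := by
    have hlim : Tendsto (fun ε : ℝ => ENNReal.ofReal (13 * ε)) (𝓝[>] 0) (𝓝 0) := by
      have h1 : Continuous fun ε : ℝ => ENNReal.ofReal (13 * ε) :=
        ENNReal.continuous_ofReal.comp (continuous_const.mul continuous_id)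
      have h2 := h1.tendsto 0
      rw [mul_zero, ENNReal.ofReal_zero] at h2
      exact h2.mono_left nhdsWithin_le_nhds
    refine le_antisymm (ge_of_tendsto hlim ?_) zero_le
    filter_upwards [Ioc_mem_nhdsGT (zero_lt_one (α := ℝ))] with ε hε using hmain ε hε.1 hε.2
  have h3 := (mul_eq_zero.1 hzero).resolve_left hc0
  rw [lintegral_eq_zero_iff (hmt (fun ω => ζ ω - θ ω) (hζ.sub hθm))] at h3
  filter_upwards [h3] with ω hω
  exact sub_eq_zero.1 (trunc_eq_zero.1 hω)

/-! ### Identification of the integrand at almost every time -/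

/-- The step sizes `1 / (k + 1)` along which increments are taken. -/
noncomputable def stepSize (k : ℕ) : ℝ≥0 := 1 / ((k : ℝ≥0) + 1)

theorem stepSize_pos (k : ℕ) : 0 < stepSize k := by unfold stepSize; positivity

theorem tendsto_stepSize : Tendsto stepSize atTop (𝓝 0) :=
  tendsto_one_div_add_atTop_nhds_zero_nat

theorem tendsto_coe_stepSize : Tendsto (fun k => (stepSize k : ℝ)) atTop (𝓝[>] 0) :=
  tendsto_nhdsWithin_iff.2 ⟨by
    have := (NNReal.continuous_coe.tendsto 0).comp tendsto_stepSize
    simpa [Function.comp_def] using this, Eventually.of_forall fun k => NNReal.coe_pos.2 (stepSize_pos k)⟩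

theorem tendsto_sqrt_stepSize : Tendsto (fun k => √(stepSize k : ℝ)) atTop (𝓝 0) := by
  have := (Real.continuous_sqrt.tendsto 0).comp
    (tendsto_coe_stepSize.mono_right nhdsWithin_le_nhds)
  rwa [Real.sqrt_zero] at this

theorem HasDerivAt.tendsto_inv_sqrt_mul_increment {f : ℝ → ℝ} {f' s : ℝ} (h : HasDerivAt f f' s) :
    Tendsto (fun k => (√(stepSize k : ℝ))⁻¹ * (f (s + stepSize k) - f s)) atTop (𝓝 0) := by
  have h1 := (hasDerivAt_iff_tendsto_slope_zero.1 h).mono_left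
    (nhdsWithin_mono 0 fun x (hx : 0 < x) => hx.ne')
  have h2 := tendsto_sqrt_stepSize.mul (h1.comp tendsto_coe_stepSize)
  rw [zero_mul] at h2
  refine h2.congr fun k => ?_
  have hpos : (0 : ℝ) < stepSize k := NNReal.coe_pos.2 (stepSize_pos k)
  simp only [Function.comp_apply, smul_eq_mul]
  rw [← mul_assoc]
  congr 1
  have h3 := Real.sqrt_pos.2 hpos
  have h4 := Real.mul_self_sqrt hpos.le
  rw [eq_comm, inv_eq_iff_eq_inv, mul_inv, inv_inv, inv_mul_eq_div, eq_div_iff h3.ne', h4]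

section

variable {Ω : Type*} {mΩ : MeasurableSpace Ω} {P : Measure Ω}

/-- If almost every path of `β` is differentiable almost everywhere, then at almost every time the
increments of `β` are almost surely negligible with respect to the square root of the step. -/
theorem ae_tendsto_inv_sqrt_mul_increment [SFinite P] {β : ℝ → Ω → ℝ} {A : Set ℝ}
    (hA : MeasurableSet A) (hβ : ∀ r, Measurable (β r))
    (hc : ∀ᵐ ω ∂P, Continuous fun r => β r ω)
    (hd : ∀ᵐ ω ∂P, ∀ᵐ s : ℝ, s ∈ A → DifferentiableAt ℝ (fun r => β r ω) s) :
    ∀ᵐ s : ℝ, s ∈ A → ∀ᵐ ω ∂P, Tendsto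
      (fun k => (√(stepSize k : ℝ))⁻¹ * (β (s + stepSize k) ω - β s ω)) atTop (𝓝 0) := by
  obtain ⟨N, hNsub, hNm, hN0⟩ := exists_measurable_superset_of_null (ae_iff.1 hc)
  set γ : ℝ → Ω → ℝ := fun r => Nᶜ.indicator (β r) with hγ
  have hγeq : ∀ᵐ ω ∂P, ∀ r, γ r ω = β r ω := by
    filter_upwards [measure_eq_zero_iff_ae_notMem.1 hN0] with ω hω r
    exact Set.indicator_of_mem (s := Nᶜ) hω _
  have hγc : ∀ ω, Continuous fun r => γ r ω := by
    intro ω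
    by_cases hω : ω ∈ N
    · have : (fun r => γ r ω) = fun _ => 0 := funext fun r =>
        Set.indicator_of_notMem (s := Nᶜ) (fun h => h hω) _
      rw [this]; exact continuous_const
    · have : (fun r => γ r ω) = fun r => β r ω := funext fun r =>
        Set.indicator_of_mem (s := Nᶜ) hω _
      rw [this]
      by_contra hcon
      exact hω (hNsub hcon)
  have hγm : Measurable (Function.uncurry γ) :=
    measurable_uncurry_of_continuous_of_measurable hγc fun r => (hβ r).indicator hNm.compl
  have hm : MeasurableSet {x : ℝ × Ω | x.1 ∈ A → Tendsto
      (fun k => (√(stepSize k : ℝ))⁻¹ * (γ (x.1 + stepSize k) x.2 - γ x.1 x.2)) atTop (𝓝 0)} := by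
    have h1 : MeasurableSet {x : ℝ × Ω | Tendsto
      (fun k => (√(stepSize k : ℝ))⁻¹ * (γ (x.1 + stepSize k) x.2 - γ x.1 x.2)) atTop (𝓝 0)} := by
      refine measurableSet_tendsto (𝓝 0) fun k => ?_
      refine Measurable.const_mul (Measurable.sub ?_ hγm) _
      exact hγm.comp ((measurable_fst.add_const _).prodMk measurable_snd)
    have h2 : MeasurableSet {x : ℝ × Ω | x.1 ∈ A} := measurable_fst hA
    have : {x : ℝ × Ω | x.1 ∈ A → Tendsto
      (fun k => (√(stepSize k : ℝ))⁻¹ * (γ (x.1 + stepSize k) x.2 - γ x.1 x.2)) atTop (𝓝 0)}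
      = {x : ℝ × Ω | x.1 ∈ A}ᶜ ∪ {x : ℝ × Ω | Tendsto
      (fun k => (√(stepSize k : ℝ))⁻¹ * (γ (x.1 + stepSize k) x.2 - γ x.1 x.2)) atTop (𝓝 0)} := by
      ext x
      simp only [Set.mem_ofPred_eq, Set.mem_union, Set.mem_compl_iff]
      tauto
    rw [this]
    exact h2.compl.union h1
  have hpaths : ∀ᵐ ω ∂P, ∀ᵐ s : ℝ, s ∈ A → Tendsto
      (fun k => (√(stepSize k : ℝ))⁻¹ * (γ (s + stepSize k) ω - γ s ω)) atTop (𝓝 0) := by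
    filter_upwards [hd, hγeq] with ω hω hω'
    filter_upwards [hω] with s hs hsA
    simp_rw [hω']
    exact HasDerivAt.tendsto_inv_sqrt_mul_increment (hs hsA).hasDerivAt
  filter_upwards [(Measure.ae_ae_comm (μ := P) (ν := volume)
    (p := fun ω (s : ℝ) => s ∈ A → Tendsto
      (fun k => (√(stepSize k : ℝ))⁻¹ * (γ (s + stepSize k) ω - γ s ω)) atTop (𝓝 0))
    (measurable_swap hm)).1 hpaths] with s hs hsA
  filter_upwards [hs, hγeq] with ω hω hω'
  simp_rw [hω'] at hω
  exact hω hsA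

theorem measurable_dslope_comp {f : ℝ → ℝ} (hf : Measurable f) {X Y : Ω → ℝ} (hX : Measurable X)
    (hY : Measurable Y) : Measurable fun ω => dslope f (X ω) (Y ω) := by
  classical
  have h1 : (fun ω => dslope f (X ω) (Y ω))
      = fun ω => if Y ω = X ω then deriv f (X ω) else (Y ω - X ω)⁻¹ * (f (Y ω) - f (X ω)) := by
    funext ω
    simp only [dslope, Function.update_apply, slope, vsub_eq_sub, smul_eq_mul]
  rw [h1]
  exact Measurable.ite (measurableSet_eq_fun hY hX) ((measurable_deriv f).comp hX)
    ((hY.sub hX).inv.mul ((hf.comp hY).sub (hf.comp hX)))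

/-- `v` is Lipschitz in time, locally uniformly in space. -/
theorem IsC12.exists_time_lipschitz {T : ℝ} {v : ℝ → ℝ → ℝ} (hv : IsC12 T v) (R : ℝ) :
    ∃ L, ∀ s ∈ Set.Icc 0 T, ∀ u ∈ Set.Icc 0 T, ∀ x, |x| ≤ R → |v u x - v s x| ≤ L * |u - s| := by
  have hK : IsCompact (Set.Icc 0 T ×ˢ Set.Icc (-R) R) := isCompact_Icc.prod isCompact_Icc
  obtain ⟨L, hL⟩ := hK.exists_bound_of_continuousOn
    (hv.continuousOn_time.mono (Set.prod_mono le_rfl (Set.subset_univ _)))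
  refine ⟨L, fun s hs u hu x hx => ?_⟩
  exact (convex_Icc 0 T).norm_image_sub_le_of_norm_derivWithin_le
    (fun r hr => hv.diff_time r hr x) (fun r hr => hL (r, x) ⟨hr, abs_le.1 hx⟩) hs hu

variable {𝓕 : Filtration ℝ≥0 mΩ} {W : ℝ≥0 → Ω → ℝ}

theorem SimpleIntegrand.measurable_eval_filtration (S : SimpleIntegrand 𝓕) (s : ℝ≥0) :
    Measurable[𝓕 s] (S.eval s) := by
  refine Finset.measurable_sum _ fun i _ => ?_
  by_cases hs : s ∈ Set.Ioc (S.time i) (S.time (i + 1))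
  · simp only [Set.indicator, hs, if_true]
    exact (S.ξ_meas i).mono (𝓕.mono hs.1.le) le_rfl
  · simp only [Set.indicator, hs, if_false]
    exact measurable_const

/-- Shortly after a time `s` at which it does not jump, a simple integrand is constant. -/
theorem SimpleIntegrand.eventually_increment_eq (S : SimpleIntegrand 𝓕) {s : ℝ≥0}
    (hs : ∀ i, s ≠ S.time i) {u : ℕ → ℝ≥0} (hu : Tendsto u atTop (𝓝 s)) (hsu : ∀ k, s ≤ u k) :
    ∀ᶠ k in atTop, ∀ ω, S.integral W (u k) ω - S.integral W s ω
      = S.eval s ω * (W (u k) ω - W s ω) := by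
  have h : ∀ i ∈ Finset.range S.n, ∀ᶠ k in atTop, ∀ ω,
      S.ξ i ω * (W (min (S.time (i + 1)) (u k)) ω - W (min (S.time i) (u k)) ω)
        - S.ξ i ω * (W (min (S.time (i + 1)) s) ω - W (min (S.time i) s) ω)
      = (Set.Ioc (S.time i) (S.time (i + 1))).indicator (fun _ => S.ξ i ω) s
        * (W (u k) ω - W s ω) := by
    intro i _
    have hmono : S.time i ≤ S.time (i + 1) := S.time_mono (Nat.le_succ i)
    rcases lt_or_gt_of_ne (hs i) with h1 | h1
    · have h2 : s < S.time (i + 1) := h1.trans_le hmono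
      filter_upwards [hu.eventually_lt_const h1] with k hk ω
      rw [min_eq_right (hk.le.trans hmono), min_eq_right hk.le, min_eq_right h2.le,
        min_eq_right h1.le, Set.indicator_of_notMem (fun h => absurd h.1 h1.le.not_gt)]
      ring
    rcases lt_or_gt_of_ne (hs (i + 1)) with h2 | h2
    · filter_upwards [hu.eventually_lt_const h2] with k hk ω
      rw [min_eq_right hk.le, min_eq_left (h1.le.trans (hsu k)), min_eq_right h2.le,
        min_eq_left h1.le, Set.indicator_of_mem (show s ∈ Set.Ioc _ _ from ⟨h1, h2.le⟩)]
      ring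
    · refine Eventually.of_forall fun k ω => ?_
      rw [min_eq_left (h2.le.trans (hsu k)), min_eq_left (h1.le.trans (hsu k)),
        min_eq_left h2.le, min_eq_left h1.le,
        Set.indicator_of_notMem (fun h => absurd h.2 h2.not_ge)]
      ring
  filter_upwards [(Finset.range S.n).eventually_all.2 h] with k hk ω
  simp only [SimpleIntegrand.integral, SimpleIntegrand.eval, Finset.sum_mul]
  rw [← Finset.sum_sub_distrib]
  exact Finset.sum_congr rfl fun i hi => hk i hi ω

variable [IsProbabilityMeasure P] {Z : ℝ≥0 → Ω → ℝ} {T : ℝ≥0}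

theorem ae_liminf_sqDist_eq_zero (hZ : Measurable fun p : ℝ × Ω => Z p.1.toNNReal p.2)
    {S : ℕ → SimpleIntegrand 𝓕}
    (hS : Tendsto (fun n => ∫⁻ r in Set.Icc (0 : ℝ) T, sqDist P (S n) Z r) atTop (𝓝 0)) :
    ∀ᵐ s : ℝ, s ∈ Set.Icc (0 : ℝ) T → liminf (fun n => sqDist P (S n) Z s) atTop = 0 := by
  rw [← ae_restrict_iff' measurableSet_Icc]
  have h1 : ∫⁻ r in Set.Icc (0 : ℝ) T, liminf (fun n => sqDist P (S n) Z r) atTop = 0 :=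
    le_antisymm ((lintegral_liminf_le fun n => measurable_sqDist hZ (S n)).trans
      hS.liminf_eq.le) zero_le
  exact (lintegral_eq_zero_iff (Measurable.liminf fun n => measurable_sqDist hZ (S n))).1 h1

theorem ae_tendsto_average_sqDist (hZ : Measurable fun p : ℝ × Ω => Z p.1.toNNReal p.2)
    (S : SimpleIntegrand 𝓕) (hS : ∫⁻ r in Set.Icc (0 : ℝ) T, sqDist P S Z r ≠ ⊤) :
    ∀ᵐ s : ℝ, s ∈ Set.Icc (0 : ℝ) T → Tendsto
      (fun k => (∫⁻ r in Set.Icc s (s + stepSize k) ∩ Set.Icc (0 : ℝ) T, sqDist P S Z r)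
        / ENNReal.ofReal (stepSize k)) atTop (𝓝 (sqDist P S Z s)) := by
  have h1 := (IsUnifLocDoublingMeasure.vitaliFamily (volume : Measure ℝ) 1).ae_tendsto_lintegral_div
    (f := (Set.Icc (0 : ℝ) T).indicator (sqDist P S Z))
    ((measurable_sqDist hZ S).indicator measurableSet_Icc).aemeasurable
    (by rwa [lintegral_indicator measurableSet_Icc])
  filter_upwards [h1] with s hs hsT
  rw [Set.indicator_of_mem hsT] at hs
  have h2 : Tendsto (fun k => s + (stepSize k : ℝ)) atTop (𝓝[>] s) := by
    refine tendsto_nhdsWithin_iff.2 ⟨?_, Eventually.of_forall fun k => ?_⟩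
    · have := (tendsto_coe_stepSize.mono_right nhdsWithin_le_nhds).const_add s
      rwa [add_zero] at this
    · exact lt_add_of_pos_right s (NNReal.coe_pos.2 (stepSize_pos k))
  refine (hs.comp ((Real.tendsto_Icc_vitaliFamily_right s).comp h2)).congr fun k => ?_
  simp only [Function.comp_apply]
  rw [setLIntegral_indicator measurableSet_Icc, Real.volume_Icc, add_sub_cancel_left,
    Set.inter_comm]

end

section

variable {Ω : Type*} {mΩ : MeasurableSpace Ω} {P : Measure Ω} {𝓕 : Filtration ℝ≥0 mΩ}
  {W : ℝ≥0 → Ω → ℝ} {Z I : ℝ≥0 → Ω → ℝ} {T : ℝ≥0}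

theorem IsBrownianWrt.hasLaw_normalized_increment (hB : IsBrownianWrt P 𝓕 W) {s δ : ℝ≥0}
    (hδ : 0 < δ) :
    HasLaw (fun ω => (√(δ : ℝ))⁻¹ * (W (s + δ) ω - W s ω)) (gaussianReal 0 1) P := by
  have h := gaussianReal_const_mul (hB.law s (s + δ) le_self_add) (√(δ : ℝ))⁻¹
  have hδ' : (0 : ℝ) < δ := hδ
  rw [mul_zero, add_tsub_cancel_left] at h
  convert h using 2
  rw [← NNReal.coe_inj]
  push_cast
  rw [inv_pow, Real.sq_sqrt hδ'.le, inv_mul_cancel₀ hδ'.ne']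

variable [IsProbabilityMeasure P]

/-- Near a fixed time `s`, the Itô integral has increments `Z s * (W (s + δ) - W s)`, up to an error
that is small in comparison with `√δ`. If it differs from `v t (W t)` by a remainder with increments
of smaller order than `√δ`, then a first order expansion of `v` identifies `Z s`. -/
theorem ae_eq_deriv_at_time (hB : IsBrownianWrt P 𝓕 W)
    (hZ : Measurable fun p : ℝ × Ω => Z p.1.toNNReal p.2) {S : ℕ → SimpleIntegrand 𝓕}
    (hS : Tendsto (fun n => ∫⁻ r in Set.Icc (0 : ℝ) T, sqDist P (S n) Z r) atTop (𝓝 0))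
    (hIm : ∀ t ≤ T, Measurable (I t))
    (hI : ∀ t ≤ T, Tendsto (fun n => ∫⁻ ω, ‖(S n).integral W t ω - I t ω‖ₑ ^ 2 ∂P) atTop (𝓝 0))
    {v : ℝ → ℝ → ℝ} (hv : IsC12 T v) {s : ℝ≥0} (hsT : s < T) (hjump : ∀ n i, s ≠ (S n).time i)
    (hliminf : liminf (fun n => sqDist P (S n) Z s) atTop = 0)
    (havg : ∀ n, ∫⁻ r in Set.Icc (0 : ℝ) T, sqDist P (S n) Z r ≠ ⊤ → Tendsto
      (fun k => (∫⁻ r in Set.Icc (s : ℝ) (s + stepSize k) ∩ Set.Icc (0 : ℝ) T,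
        sqDist P (S n) Z r) / ENNReal.ofReal (stepSize k)) atTop (𝓝 (sqDist P (S n) Z s)))
    (hrem : ∀ᵐ ω ∂P, Tendsto (fun k => (√(stepSize k : ℝ))⁻¹ *
      ((I (min (s + stepSize k) T) ω
        - v (min (s + stepSize k) T : ℝ≥0) (W (min (s + stepSize k) T) ω))
      - (I s ω - v s (W s ω)))) atTop (𝓝 0)) :
    ∀ᵐ ω ∂P, Z s ω = deriv (v s) (W s ω) := by
  have hsTR : (s : ℝ) ∈ Set.Icc (0 : ℝ) T := ⟨s.coe_nonneg, NNReal.coe_le_coe.2 hsT.le⟩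
  have hWm := hB.measurable
  set u : ℕ → ℝ≥0 := fun k => min (s + stepSize k) T with hu
  have huT : ∀ k, u k ≤ T := fun k => min_le_right _ _
  have hsu : ∀ k, s ≤ u k := fun k => le_min le_self_add hsT.le
  have hulim : Tendsto u atTop (𝓝 s) := by
    have h1 := (tendsto_stepSize.const_add s).min (tendsto_const_nhds (x := T))
    rwa [add_zero, min_eq_left hsT.le] at h1
  have hueq : ∀ᶠ k in atTop, u k = s + stepSize k := by
    filter_upwards [hulim.eventually_lt_const hsT] with k hk
    rcases min_cases (s + stepSize k) T with h | h
    · exact h.1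
    · exact absurd h.1 hk.ne
  have hustep : ∀ k, |(u k : ℝ) - s| ≤ stepSize k := by
    intro k
    rw [abs_of_nonneg (sub_nonneg.2 (NNReal.coe_le_coe.2 (hsu k))), sub_le_iff_le_add']
    exact_mod_cast min_le_left (s + stepSize k) T
  have hvs : ∀ r : ℝ≥0, r ≤ T → Differentiable ℝ (v r) := fun r hr =>
    hv.diff_space r ⟨r.coe_nonneg, NNReal.coe_le_coe.2 hr⟩
  have hvsm : ∀ r : ℝ≥0, r ≤ T → Measurable (v r) := fun r hr => (hvs r hr).continuous.measurable
  have hδ : ∀ k, (0 : ℝ) < stepSize k := fun k => NNReal.coe_pos.2 (stepSize_pos k)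
  have hcontW : ∀ᵐ ω ∂P, Tendsto (fun k => W (u k) ω) atTop (𝓝 (W s ω)) := by
    filter_upwards [hB.cont] with ω hω using (hω.tendsto s).comp hulim
  refine ae_eq_of_gaussian_increment (𝓕.le s) (θ := fun ω => deriv (v s) (W s ω))
    (N := fun k ω => (√(stepSize k : ℝ))⁻¹ * (W (s + stepSize k) ω - W s ω))
    (D := fun k ω => (√(stepSize k : ℝ))⁻¹ * (I (u k) ω - I s ω))
    (a := fun k ω => (√(stepSize k : ℝ))⁻¹ *
        ((I (u k) ω - v (u k) (W (u k) ω)) - (I s ω - v s (W s ω)))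
      + (√(stepSize k : ℝ))⁻¹ * (v (u k) (W (u k) ω) - v s (W (u k) ω)))
    (r := fun k ω => dslope (v s) (W s ω) (W (u k) ω) - deriv (v s) (W s ω))
    ((measurable_deriv (v s)).comp (hB.adapted s)) ?_ (fun k => ?_) (fun k => ?_) (fun k => ?_)
    (fun k => ?_) (fun k => ?_) (fun k => hB.hasLaw_normalized_increment (stepSize_pos k))
    ?_ ?_ ?_ ?_
  · have := hZ.comp (measurable_prodMk_left (x := (s : ℝ)))
    simpa [Function.comp_def] using this
  · exact ((hWm _).sub (hWm _)).const_mul _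
  · exact ((hIm _ (huT k)).sub (hIm s hsT.le)).const_mul _
  · exact ((((hIm _ (huT k)).sub ((hvsm _ (huT k)).comp (hWm _))).sub
      ((hIm s hsT.le).sub ((hvsm s hsT.le).comp (hWm _)))).const_mul _).add
      ((((hvsm _ (huT k)).comp (hWm _)).sub ((hvsm s hsT.le).comp (hWm _))).const_mul _)
  · exact (measurable_dslope_comp (hvsm s hsT.le) (hWm s) (hWm (u k))).sub
      ((measurable_deriv (v s)).comp (hWm s))
  · refine indep_of_indep_of_le_right (hB.indep s (s + stepSize k) le_self_add) ?_
    have h1 : Measurable[MeasurableSpace.comap (fun ω => W (s + stepSize k) ω - W s ω) inferInstance]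
        (fun ω => W (s + stepSize k) ω - W s ω) := comap_measurable _
    exact (h1.const_mul _).comap_le
  · -- the remainder and the time increment of `v` are `o(√δ)`
    filter_upwards [hrem, hcontW] with ω h1 h2
    obtain ⟨L, hL⟩ := hv.exists_time_lipschitz (|W s ω| + 1)
    have h3 : Tendsto (fun k => (√(stepSize k : ℝ))⁻¹ * (v (u k) (W (u k) ω) - v s (W (u k) ω)))
        atTop (𝓝 0) := by
      have h4 : Tendsto (fun k => |L| * √(stepSize k : ℝ)) atTop (𝓝 0) := by
        simpa using tendsto_sqrt_stepSize.const_mul |L|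
      refine squeeze_zero_norm' ?_ h4
      filter_upwards [h2.abs.eventually_lt_const (lt_add_one |W s ω|)] with k hk
      have h5 := hL s hsTR (u k) ⟨(u k).coe_nonneg, NNReal.coe_le_coe.2 (huT k)⟩ _ hk.le
      have h6 : L * |(u k : ℝ) - s| ≤ |L| * stepSize k :=
        (mul_le_mul_of_nonneg_right (le_abs_self L) (abs_nonneg _)).trans
          (mul_le_mul_of_nonneg_left (hustep k) (abs_nonneg L))
      rw [norm_mul, norm_inv, Real.norm_of_nonneg (Real.sqrt_nonneg _), Real.norm_eq_abs,
        inv_mul_le_iff₀ (Real.sqrt_pos.2 (hδ k))]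
      calc |v (u k) (W (u k) ω) - v s (W (u k) ω)| ≤ |L| * stepSize k := h5.trans h6
        _ = √(stepSize k : ℝ) * (|L| * √(stepSize k : ℝ)) := by
            rw [mul_left_comm, Real.mul_self_sqrt (hδ k).le]
    have h7 := h1.add h3
    rw [add_zero] at h7
    exact h7
  · filter_upwards [hcontW] with ω h1
    have h2 := (continuousAt_dslope_same.2 ((hvs s hsT.le) (W s ω))).tendsto.comp h1
    rw [dslope_same] at h2
    simpa using h2.sub_const (deriv (v s) (W s ω))
  · filter_upwards [hueq] with k hk
    refine Eventually.of_forall fun ω => ?_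
    have h1 := sub_smul_dslope (v s) (W s ω) (W (u k) ω)
    rw [smul_eq_mul] at h1
    simp only [← hk]
    linear_combination (-(√(stepSize k : ℝ))⁻¹) * h1
  · intro ε hε
    have hε2 : (0 : ℝ≥0∞) < ENNReal.ofReal (ε ^ 2) := ENNReal.ofReal_pos.2 (by positivity)
    have hfin : ∀ᶠ n in atTop, ∫⁻ r in Set.Icc (0 : ℝ) T, sqDist P (S n) Z r ≠ ⊤ := by
      filter_upwards [hS.eventually_lt_const ENNReal.zero_lt_top] with n hn using hn.ne
    have hfreq : ∃ᶠ n in atTop, sqDist P (S n) Z s < ENNReal.ofReal (ε ^ 2) := by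
      refine frequently_lt_of_liminf_lt ?_ (hliminf.trans_lt hε2)
      isBoundedDefault
    obtain ⟨n, hn1, hn2⟩ := (hfreq.and_eventually hfin).exists
    refine ⟨(S n).eval s, (S n).measurable_eval_filtration s, ?_, ?_⟩
    · have := hn1.le
      rwa [sqDist, Real.toNNReal_coe] at this
    · filter_upwards [hueq, (S n).eventually_increment_eq (W := W) (hjump n) hulim hsu,
        (havg n hn2).eventually_lt_const hn1] with k hk1 hk2 hk3
      have h1 : ∀ ω, (√(stepSize k : ℝ))⁻¹ * (I (u k) ω - I s ω)
          - (S n).eval s ω * ((√(stepSize k : ℝ))⁻¹ * (W (s + stepSize k) ω - W s ω))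
          = (√(stepSize k : ℝ))⁻¹ * ((I (u k) ω - I s ω)
            - ((S n).integral W (u k) ω - (S n).integral W s ω)) := by
        intro ω
        rw [hk2 ω, ← hk1]
        ring
      have h2 : ‖(√(stepSize k : ℝ))⁻¹‖ₑ ^ 2 = (ENNReal.ofReal (stepSize k))⁻¹ := by
        rw [Real.enorm_eq_ofReal_abs, ← ENNReal.ofReal_pow (abs_nonneg _), sq_abs, inv_pow,
          Real.sq_sqrt (hδ k).le, ENNReal.ofReal_inv_of_pos (hδ k)]
      have h3 : ENNReal.ofReal (stepSize k) ≠ 0 := (ENNReal.ofReal_pos.2 (hδ k)).ne'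
      simp_rw [h1, enorm_mul, mul_pow, h2]
      rw [lintegral_const_mul' _ _ (ENNReal.inv_ne_top.2 h3)]
      have h4 := lintegral_increment_sub_le hB hZ hS hIm hI (hsu k) (huT k) n
      have h5 : ∫⁻ r in Set.Ioc (s : ℝ) (u k), sqDist P (S n) Z r
          ≤ ∫⁻ r in Set.Icc (s : ℝ) (s + stepSize k) ∩ Set.Icc (0 : ℝ) T, sqDist P (S n) Z r := by
        refine lintegral_mono_set fun r hr => ⟨⟨hr.1.le, ?_⟩, s.coe_nonneg.trans hr.1.le,
          hr.2.trans (NNReal.coe_le_coe.2 (huT k))⟩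
        have h6 := hr.2
        rw [hk1] at h6
        exact_mod_cast h6
      calc (ENNReal.ofReal (stepSize k))⁻¹ * ∫⁻ ω, ‖(I (u k) ω - I s ω)
            - ((S n).integral W (u k) ω - (S n).integral W s ω)‖ₑ ^ 2 ∂P
          ≤ (ENNReal.ofReal (stepSize k))⁻¹ * (4 * ∫⁻ r in Set.Icc (s : ℝ) (s + stepSize k)
              ∩ Set.Icc (0 : ℝ) T, sqDist P (S n) Z r) := by
            gcongr
            exact h4.trans (mul_le_mul_right h5 4)
        _ = 4 * ((∫⁻ r in Set.Icc (s : ℝ) (s + stepSize k) ∩ Set.Icc (0 : ℝ) T,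
              sqDist P (S n) Z r) / ENNReal.ofReal (stepSize k)) := by
            rw [div_eq_mul_inv]; ring
        _ ≤ 4 * ENNReal.ofReal (ε ^ 2) := by gcongr
        _ = ENNReal.ofReal (4 * ε ^ 2) := by
            rw [ENNReal.ofReal_mul (by norm_num)]; norm_num
        _ ≤ ENNReal.ofReal (9 * ε ^ 2) := by
            refine ENNReal.ofReal_le_ofReal ?_
            nlinarith [sq_nonneg ε]

end

/-! ### The second component of the solution -/

section

variable {Ω : Type*} {mΩ : MeasurableSpace Ω} {P : Measure Ω} {𝓕 : Filtration ℝ≥0 mΩ}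

theorem measurable_of_isStronglyPredictable {Z : ℝ≥0 → Ω → ℝ} (hZ : IsStronglyPredictable 𝓕 Z) :
    Measurable fun p : ℝ × Ω => Z p.1.toNNReal p.2 := by
  have hle : 𝓕.predictable ≤ (inferInstance : MeasurableSpace (ℝ≥0 × Ω)) :=
    measurableSpace_le_predictable_of_measurableSet
      (fun A hA => (measurableSet_singleton _).prod (𝓕.le _ A hA))
      (fun i A hA => measurableSet_Ioi.prod (𝓕.le _ A hA))
  have h1 : Measurable (Function.uncurry Z) := hZ.measurable.mono hle le_rfl
  exact h1.comp ((measurable_real_toNNReal.comp measurable_fst).prodMk measurable_snd)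

theorem continuousOn_comp_path {T : ℝ≥0} {φ : ℝ → ℝ → ℝ}
    (hφ : ContinuousOn (fun p : ℝ × ℝ => φ p.1 p.2) (Set.Icc (0 : ℝ) T ×ˢ Set.univ)) {x : ℝ≥0 → ℝ}
    (hx : Continuous x) : ContinuousOn (fun t : ℝ≥0 => φ t (x t)) (Set.Icc 0 T) :=
  hφ.comp (NNReal.continuous_coe.prodMk hx).continuousOn fun t ht =>
    ⟨⟨t.coe_nonneg, NNReal.coe_le_coe.2 ht.2⟩, Set.mem_univ _⟩

/-- Two almost surely continuous processes that are modifications of each other on `[0, T]` are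
indistinguishable there. -/
theorem ae_forall_eq_of_continuousOn {T : ℝ≥0} {X Y : ℝ≥0 → Ω → ℝ}
    (hX : ∀ᵐ ω ∂P, ContinuousOn (fun t => X t ω) (Set.Icc 0 T))
    (hY : ∀ᵐ ω ∂P, ContinuousOn (fun t => Y t ω) (Set.Icc 0 T))
    (h : ∀ t ≤ T, ∀ᵐ ω ∂P, X t ω = Y t ω) : ∀ᵐ ω ∂P, ∀ t ≤ T, X t ω = Y t ω := by
  obtain ⟨D, hDc, hD⟩ := TopologicalSpace.exists_countable_dense (Set.Icc (0 : ℝ≥0) T)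
  have hall : ∀ᵐ ω ∂P, ∀ t ∈ D, X t ω = Y t ω :=
    (ae_ball_iff hDc).2 fun t _ => h t t.2.2
  filter_upwards [hX, hY, hall] with ω h1 h2 h3 t ht
  rw [continuousOn_iff_continuous_domRestrict] at h1 h2
  exact congrFun (h1.ext_on hD h2 fun t ht => h3 t ht) ⟨t, zero_le, ht⟩

theorem continuous_primitive_min {ψ : ℝ → ℝ} {T : ℝ≥0} (hψ : IntervalIntegrable ψ volume 0 T) :
    Continuous fun r : ℝ => ∫ x in (min r.toNNReal T : ℝ≥0)..(T : ℝ), ψ x := by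
  have hT : (0 : ℝ) ≤ T := T.coe_nonneg
  have h1 : ContinuousOn (fun x : ℝ => ∫ y in x..(T : ℝ), ψ y) (Set.uIcc 0 (T : ℝ)) := by
    refine intervalIntegral.continuousOn_primitive_interval_left ?_
    rw [Set.uIcc_of_le hT]
    exact (intervalIntegrable_iff_integrableOn_Icc_of_le hT).1 hψ
  have h2 : Continuous fun r : ℝ => ((min r.toNNReal T : ℝ≥0) : ℝ) :=
    NNReal.continuous_coe.comp (continuous_real_toNNReal.min continuous_const)
  refine continuousOn_univ.1 (h1.comp h2.continuousOn fun r _ => ?_)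
  rw [Set.uIcc_of_le hT]
  exact ⟨NNReal.coe_nonneg _, NNReal.coe_le_coe.2 (min_le_right _ _)⟩

theorem ae_differentiableAt_primitive_min {ψ : ℝ → ℝ} {T : ℝ≥0}
    (hψ : IntervalIntegrable ψ volume 0 T) :
    ∀ᵐ s : ℝ, s ∈ Set.Ioo (0 : ℝ) T → DifferentiableAt ℝ
      (fun r : ℝ => ∫ x in (min r.toNNReal T : ℝ≥0)..(T : ℝ), ψ x) s := by
  have hT : (0 : ℝ) ≤ T := T.coe_nonneg
  filter_upwards [hψ.ae_hasDerivAt_integral] with s hs hsT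
  rw [Set.uIcc_of_le hT] at hs
  have h1 := (hs (Set.Ioo_subset_Icc_self hsT) T ⟨hT, le_rfl⟩).neg
  refine (h1.congr_of_eventuallyEq ?_).differentiableAt
  filter_upwards [Ioo_mem_nhds hsT.1 hsT.2] with r hr
  rw [Pi.neg_apply, ← intervalIntegral.integral_symm, NNReal.coe_min,
    Real.coe_toNNReal r hr.1.le, min_eq_left hr.2.le]

variable [IsProbabilityMeasure P] {W : ℝ≥0 → Ω → ℝ} {T : ℝ≥0} {g : ℝ → ℝ}
  {h : ℝ → ℝ → ℝ → ℝ → ℝ} {Y Z : ℝ≥0 → Ω → ℝ} {v : ℝ → ℝ → ℝ}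

/-- Almost everywhere in time, `Z s = v'(s, W s)` almost surely. -/
theorem IsBSDESolution.ae_eq_deriv (hB : IsBrownianWrt P 𝓕 W)
    (hYZ : IsBSDESolution P 𝓕 W T g h Y Z) (hv : IsC12 T v)
    (hYv : ∀ t ≤ T, ∀ᵐ ω ∂P, Y t ω = v t (W t ω)) :
    ∀ᵐ s : ℝ, s ∈ Set.Ioo (0 : ℝ) T →
      ∀ᵐ ω ∂P, Z s.toNNReal ω = deriv (v s) (W s.toNNReal ω) := by
  obtain ⟨I, hI, heq⟩ := hYZ.equation
  obtain ⟨S, hS, hlim⟩ := hI.limit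
  have hIm : ∀ t ≤ T, Measurable (I t) := fun t ht => (hI.adapted t ht).mono (𝓕.le t) le_rfl
  set Z' : ℝ≥0 → Ω → ℝ := fun t ω => if t ≤ T then Z t ω else 0 with hZ'
  have hZ'm : Measurable fun p : ℝ × Ω => Z' p.1.toNNReal p.2 :=
    measurable_of_isStronglyPredictable hYZ.Z_predictable
  have hS' : Tendsto (fun n => ∫⁻ r in Set.Icc (0 : ℝ) T, sqDist P (S n) Z' r) atTop (𝓝 0) := by
    refine hS.congr fun n => ?_
    rw [lintegral_sqDist hZ'm]
    refine lintegral_congr fun ω => setLIntegral_congr_fun measurableSet_Icc fun r hr => ?_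
    have : r.toNNReal ≤ T := Real.toNNReal_le_iff_le_coe.2 hr.2
    simp only [hZ', this, if_true]
  have hYv' : ∀ᵐ ω ∂P, ∀ t ≤ T, Y t ω = v t (W t ω) := by
    refine ae_forall_eq_of_continuousOn hYZ.Y_continuous ?_ hYv
    filter_upwards [hB.cont] with ω hω using continuousOn_comp_path hv.continuousOn hω
  -- `β` is the difference `I - v(·, W)`, frozen after the time `T`. By the equation its paths are,
  -- up to a constant, primitives of the driver, so they have no component of order `√δ`.
  set β : ℝ → Ω → ℝ := fun r ω => I (min r.toNNReal T) ω
    - v (min r.toNNReal T : ℝ≥0) (W (min r.toNNReal T) ω) with hβ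
  have hβm : ∀ r, Measurable (β r) := by
    intro r
    have hr : min r.toNNReal T ≤ T := min_le_right _ _
    exact (hIm _ hr).sub ((hv.diff_space _ ⟨NNReal.coe_nonneg _,
      NNReal.coe_le_coe.2 hr⟩).continuous.measurable.comp (hB.measurable _))
  have hβeq : ∀ᵐ ω ∂P, (fun r => β r ω) = fun r => (I T ω - g (W T ω))
      - ∫ x in (min r.toNNReal T : ℝ≥0)..(T : ℝ),
        h x (W x.toNNReal ω) (Y x.toNNReal ω) (Z x.toNNReal ω) := by
    filter_upwards [heq, hYv'] with ω h1 h2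
    funext r
    have h3 := h1 (min r.toNNReal T) (min_le_right _ _)
    rw [h2 _ (min_le_right _ _)] at h3
    simp only [hβ]
    linear_combination -h3
  have hrem := ae_tendsto_inv_sqrt_mul_increment (P := P) (β := β) (A := Set.Ioo (0 : ℝ) T)
    measurableSet_Ioo hβm
    (by
      filter_upwards [hβeq, hYZ.driver_integrable] with ω h1 h2
      rw [h1]
      exact continuous_const.sub (continuous_primitive_min h2))
    (by
      filter_upwards [hβeq, hYZ.driver_integrable] with ω h1 h2
      rw [h1]
      filter_upwards [ae_differentiableAt_primitive_min h2] with s hs hsT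
      exact (differentiableAt_const _).sub (hs hsT))
  have hjump : ∀ᵐ s : ℝ, ∀ n i, s ≠ (S n).time i := by
    rw [ae_all_iff]; intro n
    rw [ae_all_iff]; intro i
    exact Measure.ae_ne volume _
  have havg : ∀ᵐ s : ℝ, ∀ n, ∫⁻ r in Set.Icc (0 : ℝ) T, sqDist P (S n) Z' r ≠ ⊤ →
      s ∈ Set.Icc (0 : ℝ) T → Tendsto
      (fun k => (∫⁻ r in Set.Icc s (s + stepSize k) ∩ Set.Icc (0 : ℝ) T, sqDist P (S n) Z' r)
        / ENNReal.ofReal (stepSize k)) atTop (𝓝 (sqDist P (S n) Z' s)) := by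
    rw [ae_all_iff]; intro n
    by_cases hn : ∫⁻ r in Set.Icc (0 : ℝ) T, sqDist P (S n) Z' r = ⊤
    · exact Eventually.of_forall fun s h1 => absurd hn h1
    · filter_upwards [ae_tendsto_average_sqDist hZ'm (S n) hn] with s hs _ using hs
  filter_upwards [hrem, hjump, havg, ae_liminf_sqDist_eq_zero hZ'm hS'] with s h1 h2 h3 h4 hsT
  have hsT' : s ∈ Set.Icc (0 : ℝ) T := Set.Ioo_subset_Icc_self hsT
  specialize h1 hsT
  lift s to ℝ≥0 using hsT.1.le
  have hsT2 : s < T := NNReal.coe_lt_coe.1 hsT.2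
  have h5 := ae_eq_deriv_at_time hB hZ'm hS' hIm hlim hv hsT2
    (fun n i hni => h2 n i (by rw [hni])) (h4 hsT') (fun n hn => h3 n hn hsT') (by
      simp only [hβ, ← NNReal.coe_add, Real.toNNReal_coe, min_eq_left hsT2.le] at h1
      exact h1)
  rw [Real.toNNReal_coe]
  filter_upwards [h5] with ω hω
  simpa only [hZ', if_pos hsT2.le] using hω

/-- If `Z` has continuous paths, then `Z t = v'(t, W t)` almost surely at every time `t > 0`. -/
theorem IsBSDESolution.eq_deriv_of_continuousOn (hB : IsBrownianWrt P 𝓕 W)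
    (hYZ : IsBSDESolution P 𝓕 W T g h Y Z) (hv : IsC12 T v)
    (hYv : ∀ t ≤ T, ∀ᵐ ω ∂P, Y t ω = v t (W t ω))
    (hZc : ∀ᵐ ω ∂P, ContinuousOn (fun s => Z s ω) (Set.Icc 0 T)) {t : ℝ≥0} (ht : 0 < t)
    (htT : t ≤ T) : ∀ᵐ ω ∂P, Z t ω = deriv (v t) (W t ω) := by
  -- The identity holds at a dense set of times, and both sides are continuous in time.
  have hdense := Measure.dense_of_ae (hYZ.ae_eq_deriv hB hv hYv)
  have hT : (0 : ℝ) < T := NNReal.coe_pos.2 (ht.trans_le htT)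
  have htcl : (t : ℝ) ∈ closure (Set.Ioo (0 : ℝ) T) := by
    rw [closure_Ioo hT.ne]
    exact ⟨t.coe_nonneg, NNReal.coe_le_coe.2 htT⟩
  obtain ⟨x, hx, hxt⟩ := mem_closure_iff_seq_limit.1
    (closure_minimal (hdense.open_subset_closure_inter isOpen_Ioo) isClosed_closure htcl)
  have hall : ∀ᵐ ω ∂P, ∀ n, Z (x n).toNNReal ω = deriv (v (x n)) (W (x n).toNNReal ω) :=
    ae_all_iff.2 fun n => (hx n).2 (hx n).1
  have hlim : Tendsto (fun n => (x n).toNNReal) atTop (𝓝[Set.Icc 0 T] t) := by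
    refine tendsto_nhdsWithin_iff.2 ⟨?_, Eventually.of_forall fun n => ⟨zero_le,
      Real.toNNReal_le_iff_le_coe.2 (hx n).1.2.le⟩⟩
    have := (continuous_real_toNNReal.tendsto (t : ℝ)).comp hxt
    rwa [Real.toNNReal_coe] at this
  filter_upwards [hall, hZc, hB.cont] with ω h1 h2 h3
  have h4 := (h2 t ⟨zero_le, htT⟩).tendsto.comp hlim
  have h5 := (continuousOn_comp_path (φ := fun s x => deriv (v s) x) hv.continuousOn_space h3 t
    ⟨zero_le, htT⟩).tendsto.comp hlim
  refine tendsto_nhds_unique h4 (h5.congr fun n => ?_)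
  simp only [Function.comp_apply]
  rw [h1 n, Real.coe_toNNReal _ (hx n).1.1.le]

end

end BSDEDensity


theorem mainTheorem6 {Ω : Type*} [mΩ : MeasurableSpace Ω] (P : Measure Ω)
    [IsProbabilityMeasure P] (T : ℝ≥0)
    (W : ℝ≥0 → Ω → ℝ) (hWm : ∀ t, Measurable (W t)) (hW : IsBrownianReal W P)
    (g : ℝ → ℝ) (h : ℝ → ℝ → ℝ → ℝ → ℝ) (Y Z : ℝ≥0 → Ω → ℝ)
    (hYZ : BSDEDensity.IsBSDESolution P (BSDEDensity.augmentedFiltration P W hWm) W T g h Y Z)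
    (v : ℝ → ℝ → ℝ) (hv : BSDEDensity.IsC12 T v)
    (hYv : ∀ t ≤ T, ∀ᵐ ω ∂P, Y t ω = v t (W t ω))
    (t : ℝ≥0) (ht : 0 < t) (htT : t ≤ T) :
    (∀ K a : ℝ, BSDEDensity.TailAssumptions (v t) K a →
      BSDEDensity.HasTailEstimates P (Y t) t (v t) a) ∧
    ((∀ᵐ ω ∂P, ContinuousOn (fun s => Z s ω) (Set.Icc 0 T)) →
      ∀ K a : ℝ, BSDEDensity.TailAssumptions (deriv (v t)) K a →
        BSDEDensity.HasTailEstimates P (Z t) t (deriv (v t)) a) := by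
  have htI : (t : ℝ) ∈ Set.Icc (0 : ℝ) T := ⟨t.coe_nonneg, NNReal.coe_le_coe.2 htT⟩
  have hlaw := hW.hasLaw_eval t
  have hd2 : Continuous (deriv (deriv (v t))) := by
    have h1 : ContinuousOn (fun x : ℝ => deriv (deriv (v t)) x) Set.univ :=
      hv.continuousOn_space_two.comp (f := fun x : ℝ => ((t : ℝ), x)) (by fun_prop)
        fun x _ => ⟨htI, Set.mem_univ _⟩
    exact continuousOn_univ.1 h1
  refine ⟨fun K a hK => ?_, fun hZc K a hK => ?_⟩
  · exact BSDEDensity.hasTailEstimates_of_hasLaw ht hlaw (hYv t htT) (hv.diff_space t htI)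
      (hv.diff_space_two t htI).continuous hK
  · exact BSDEDensity.hasTailEstimates_of_hasLaw ht hlaw
      (hYZ.eq_deriv_of_continuousOn (BSDEDensity.isBrownianWrt_augmentedFiltration hWm hW) hv hYv
        hZc ht htT) (hv.diff_space_two t htI) hd2 hK
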